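/- All CW complexes are finite. A CW complex $K$ \emph{collapses elementarily} to a subcomplex $L$ if $K=L\cup e^{k}\cup e^{k+1}$ with two cells $e^k,e^{k+1}$ not in $L$, and there is a map $\psi:D^{k+1}\to K$ and a decomposition of $\partial D^{k+1}$ into two $k$-discs $F,P$ meeting in their common boundary (for $D^{k+1}=[-1,1]^{k+1}$: $F$ is the face on which the last coordinate is $1$, and $P$ is the closure of $\partial D^{k+1}\smallsetminus F$) such that $\psi$ is a characteristic map for $e^{k+1}$, $\psi|_F$ is a characteristic map for $e^{k}$, and $\psi(P)$ lies in the $k$-skeleton of $L$. The standard retraction $\rho:D^{k+1}\to P$ (radial projection from a point above the centre of $F$) induces the canonical strong deformation retraction $r:K\to L$ with $r|_L=\mathrm{id}$ and $r\psi=\psi\rho$. We say that $K$ \emph{collapses} to $L$, $K\searrow L$ (or that $L$ \emph{expands} to $K$, $L\nearrow K$), if there is a finite sequence of elementary collapses from $K$ to $L$; its canonical strong deformation retraction $K\to L$ is the composition of those of the elementary collapses. \textbf{Proposition.} Let $K\cup\bigcup_{i=1}^d e_i$ be a CW complex, obtained from the subcomplex $K$ by attaching successively the cells $e_1,\dots,e_d$,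 where $\dim K\le\dim e_i\le n$ for all $1\le i\le d$ and $\dim e_i\le \dim e_{i+1}$ for all $1\le i<d$. Let $\varphi_j:\partial D_j\to K\cup\bigcup_{i<j}e_i$ be the attaching map of $e_j$. Suppose that $K\searrow L$, and let $r_0:K\to L$ be the canonical strong deformation retraction of this collapse. Then there exist CW complexes $Z_1\le Z_2\le\dots\le Z_d$ (each a subcomplex of the next) of dimension at most $n+1$, such that for every $j=1,\dots,d$ $$K\cup\bigcup_{i=1}^{j}e_i\ \nearrow\ Z_j\ \searrow\ L\cup\bigcup_{i=1}^{j}\tilde e_i ,$$ where $\dim\tilde e_j=\dim e_j$ and the attaching map $\tilde\varphi_j:\partial D_j\to L\cup\bigcup_{i<j}\tilde e_i$ of the cell $\tilde e_j$ is defined inductively as follows: $\tilde\varphi_1=r_0\varphi_1$, and for $j>1$, $\tilde\varphi_j=\tilde r_{j-1}\,\iota_{j-1}\,\varphi_j$, where $\tilde r_{j-1}:Z_{j-1}\to L\cup\bigcup_{i<j}\tilde e_i$ is the canonical strong deformation retraction of the collapse and $\iota_{j-1}:K\cup\bigcup_{i<j}e_i\to Z_{j-1}$ is the inclusion. These inclusions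 are compatible with one another and with those of the complexes $K\cup\bigcup_{i\le j}e_i$ and of the complexes $Z_j$. -/

import Mathlib

open Set Metric Topology

universe u

noncomputable section

namespace InternalCollapse

/-! Throughout, CW complexes are Mathlib's `CWComplex`: the model of the closed `n`-disc `Dⁿ` is
`closedBall 0 1` in `Fin n → ℝ` with the sup norm, i.e. the cube `[-1,1]ⁿ`, and its boundary is
`sphere 0 1`. -/

variable {X : Type u} [TopologicalSpace X] [T2Space X] {C : Set X} [CWComplex C]

/-- The subcomplex `A` has dimension at most `n`: it has no cell of dimension larger than `n`. -/
def DimLE (A : CWComplex.Subcomplex C) (n : ℕ) : Prop :=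
  ∀ k, n < k → A.I k = ∅

/-- `B = A ∪ eᵐ`: the subcomplex `B` arises from the subcomplex `A` by attaching the single
`m`-cell `e`, which is not a cell of `A`. -/
def IsCellAttachment (A B : CWComplex.Subcomplex C) (m : ℕ) (e : RelCWComplex.cell C m) : Prop :=
  e ∉ A.I m ∧ (B : Set X) = (A : Set X) ∪ RelCWComplex.openCell m e

/-- `ψ : Dⁿ → X` is a characteristic map for the `n`-cell `e` (not necessarily the one that is part
of the chosen structure): it is continuous, it maps the interior of `Dⁿ` bijectively onto the open
cell, and it maps the boundary of `Dⁿ` into the union of the cells of dimension `< n`. (As `Dⁿ` is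
compact and `X` is Hausdorff, the interior is then mapped homeomorphically onto the open cell.) -/
structure IsCharMap (n : ℕ) (e : RelCWComplex.cell C n) (ψ : (Fin n → ℝ) → X) : Prop where
  continuousOn : ContinuousOn ψ (closedBall 0 1)
  injOn : InjOn ψ (ball 0 1)
  image_eq : ψ '' ball 0 1 = RelCWComplex.openCell n e
  mapsTo : MapsTo ψ (sphere 0 1) (CWComplex.skeletonLT C n : Set X)

/-- The closed face `{x_{last} = 1}` of the cube `D^{k+1}` is a `k`-disc in `∂D^{k+1}`, the *free
face*; it is parametrized by `Dᵏ` through `y ↦ (y, 1)`. -/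
def freeFace (k : ℕ) (y : Fin k → ℝ) : Fin (k + 1) → ℝ :=
  Fin.snoc (α := fun _ => ℝ) y 1

/-- The closure of the complement of the free face in `∂D^{k+1}`; it is a `k`-disc, too. -/
def baseFace (k : ℕ) : Set (Fin (k + 1) → ℝ) :=
  closure (sphere 0 1 \ {x | x (Fin.last k) = 1})

/-- The standard retraction of `D^{k+1}` onto the disc `baseFace k`: the radial projection from the
point `(0, 3)` above the free face. For `x = (y, t)` it is `(λ y, 3 - λ (3 - t))` where
`λ⁻¹ = max ‖y‖ ((3 - t) / 4)`. -/
def discRetraction (k : ℕ) (x : Fin (k + 1) → ℝ) : Fin (k + 1) → ℝ :=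
  let y : Fin k → ℝ := fun i => x i.castSucc
  let t : ℝ := x (Fin.last k)
  let l : ℝ := (max ‖y‖ ((3 - t) / 4))⁻¹
  Fin.snoc (α := fun _ => ℝ) (l • y) (3 - l * (3 - t))

/-- The subcomplex `K` collapses elementarily to the subcomplex `L`, and `r` is (on `K`) the
canonical retraction of this elementary collapse: `K = L ∪ aᵏ ∪ b^{k+1}` with cells `a`, `b` not
in `L`, and there is a map `ψ : D^{k+1} → K` which is a characteristic map for `b`, whose
restriction to the free face is a characteristic map for `a`, and which maps the rest of
`∂D^{k+1}` into the `k`-skeleton of `L`. The retraction is the identity on `L` and is induced on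
the two cells by the standard retraction of `D^{k+1}`. The values of `r` outside `K` do not
matter. -/
def ElementaryCollapsesVia (K L : CWComplex.Subcomplex C) (r : X → X) : Prop :=
  ∃ (k : ℕ) (a : RelCWComplex.cell C k) (b : RelCWComplex.cell C (k + 1)) (ψ : (Fin (k + 1) → ℝ) → X),
    a ∉ L.I k ∧ b ∉ L.I (k + 1) ∧
    (K : Set X) = (L : Set X) ∪ RelCWComplex.openCell k a ∪ RelCWComplex.openCell (k + 1) b ∧
    IsCharMap (k + 1) b ψ ∧
    IsCharMap k a (fun y => ψ (freeFace k y)) ∧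
    MapsTo ψ (baseFace k) ((L : Set X) ∩ (CWComplex.skeleton C k : Set X)) ∧
    EqOn r id L ∧
    ∀ x ∈ closedBall (0 : Fin (k + 1) → ℝ) 1, r (ψ x) = ψ (discRetraction k x)

/-- `K` collapses to `L` by a finite (possibly empty) sequence of elementary collapses, and `r` is
(on `K`) the composition of their canonical retractions, i.e. `r : K → L` is the canonical strong
deformation retraction of the collapse. -/
inductive CollapsesVia : CWComplex.Subcomplex C → CWComplex.Subcomplex C → (X → X) → Prop
  | refl (K : CWComplex.Subcomplex C) (r : X → X) (hr : EqOn r id K) : CollapsesVia K K r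
  | step (K K' L : CWComplex.Subcomplex C) (r₁ r₂ r : X → X)
      (h₁ : ElementaryCollapsesVia K K' r₁) (h₂ : CollapsesVia K' L r₂)
      (hr : EqOn r (r₂ ∘ r₁) K) : CollapsesVia K L r

/-- `K` collapses to `L`; equivalently, `L` expands to `K`. -/
def Collapses (K L : CWComplex.Subcomplex C) : Prop :=
  ∃ r : X → X, CollapsesVia K L r

/-- `r` is (on `A`) a strong deformation retraction of `A` onto its subset `B`. -/
def IsStrongDeformationRetraction {Y : Type u} [TopologicalSpace Y] (A B : Set Y) (r : Y → Y) :
    Prop :=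
  B ⊆ A ∧ MapsTo r A B ∧ ∃ H : Y × ℝ → Y,
    ContinuousOn H (A ×ˢ Icc 0 1) ∧ MapsTo H (A ×ˢ Icc 0 1) A ∧
    (∀ x ∈ A, H (x, 0) = x) ∧ (∀ x ∈ A, H (x, 1) = r x) ∧
    ∀ x ∈ B, ∀ t ∈ Icc (0 : ℝ) 1, H (x, t) = x

/-- The inclusion of a CW complex `X` as a subcomplex of a CW complex `Y`: a closed embedding that
maps each cell of `X` to a cell of `Y` of the same dimension, respecting the characteristic
maps. -/
structure CellularInclusion (X Y : Type u) [TopologicalSpace X] [TopologicalSpace Y]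
    [CWComplex (univ : Set X)] [CWComplex (univ : Set Y)] where
  toFun : X → Y
  cellMap : (n : ℕ) → RelCWComplex.cell (univ : Set X) n → RelCWComplex.cell (univ : Set Y) n
  isClosedEmbedding : IsClosedEmbedding toFun
  map_eq : ∀ (n : ℕ) (c : RelCWComplex.cell (univ : Set X) n), ∀ x ∈ closedBall (0 : Fin n → ℝ) 1,
    toFun (RelCWComplex.map n c x) = RelCWComplex.map n (cellMap n c) x

/-- The image of a subcomplex under the inclusion of a CW complex as a subcomplex. -/
def CellularInclusion.image {X Y : Type u} [TopologicalSpace X] [TopologicalSpace Y]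
    [CWComplex (univ : Set X)] [CWComplex (univ : Set Y)] (ι : CellularInclusion X Y)
    (A : CWComplex.Subcomplex (univ : Set X)) : CWComplex.Subcomplex (univ : Set Y) where
  carrier := ι.toFun '' A
  I n := ι.cellMap n '' A.I n
  closed' := ι.isClosedEmbedding.isClosedMap _ A.closed'
  union' := by
    have key : ∀ (n : ℕ) (c : RelCWComplex.cell (univ : Set X) n),
        RelCWComplex.openCell n (ι.cellMap n c) = ι.toFun '' RelCWComplex.openCell n c := by
      intro n c
      unfold RelCWComplex.openCell
      rw [image_image]
      exact image_congr fun x hx => (ι.map_eq n c x (ball_subset_closedBall hx)).symm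
    rw [← CWComplex.Subcomplex.union (E := A), empty_union]
    simp only [image_iUnion, ← key]
    ext y
    simp

end InternalCollapse

end

/-!
Put `Z₀ = K` and `M₀ = L`. The complexes `Z_j` are built one cell at a time, so that `Z_j` collapses
both to `A_j = K ∪ e₁ ∪ … ∪ e_j` and to `M_j = L ∪ ẽ₁ ∪ … ∪ ẽ_j`. Let `r : Z → M` be the canonical
retraction of the collapse found so far and `e` the next cell, with attaching map `φ`. One attaches
a cell `e'` along `r φ`, and then a prism `E` over the disc of `e`: its top is `e`, its bottom is
`e'`, and its vertical sides follow the homotopy from the identity to `r`, applied to `φ`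
(`exists_prism`). The prism can be collapsed from the bottom, which leaves `Z ∪ e`, or from the top,
which leaves `Z ∪ e'`. A collapse of `Z` extends by the identity to a complex that meets `Z` only in
the target of the collapse (`CollapsesVia.union`), so `Z ∪ e` collapses to `A ∪ e` and `Z ∪ e'` to
`M ∪ e'` (`exists_collapses_of_isCellAttachment`).

For the attaching map of `E` to be cellular, the homotopy must map the `p`-skeleton to the
`(p+1)`-skeleton and `r` must preserve skeleta. Both hold for an elementary collapse, as a point of
the removed pair of cells `aᵏ`, `b^{k+1}` moves inside the closure of `b` and ends in the
`k`-skeleton, and both are stable under composition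
(`CollapsesVia.exists_isCellularDeformation`). That a cell can be attached to a finite CW complex,
with a Hausdorff finite CW complex as the result, is `exists_attachCell`.
-/

noncomputable section

namespace InternalCollapse

/-! ### Subcomplexes and characteristic maps -/

section Subcomplex

variable {X : Type u} [TopologicalSpace X] {C : Set X} [CWComplex C]

lemma mem_I_of_mem_openCell {A : CWComplex.Subcomplex C} {n : ℕ} {c : RelCWComplex.cell C n}
    {x : X} (hx : x ∈ RelCWComplex.openCell n c) (hA : x ∈ A) : c ∈ A.I n := by
  by_contra h
  exact (CWComplex.Subcomplex.disjoint_openCell_subcomplex_of_not_mem A h).notMem_of_mem_left hx hA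

lemma disjoint_openCell_succ {k : ℕ} {a : RelCWComplex.cell C k}
    {b : RelCWComplex.cell C (k + 1)} :
    Disjoint (RelCWComplex.openCell k a) (RelCWComplex.openCell (k + 1) b) :=
  CWComplex.disjoint_openCell_of_ne (C := C) fun h => by
    have := congrArg Sigma.fst h
    simp at this

variable [T2Space X]

lemma openCell_subset_iff {A : CWComplex.Subcomplex C} {n : ℕ} {c : RelCWComplex.cell C n} :
    RelCWComplex.openCell n c ⊆ A ↔ c ∈ A.I n := by
  refine ⟨fun h => ?_, fun h => CWComplex.Subcomplex.openCell_subset_of_mem A h⟩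
  obtain ⟨x, hx⟩ := RelCWComplex.openCell_nonempty n c
  exact mem_I_of_mem_openCell hx (h hx)

lemma mem_skeletonLT_iff_of_mem_openCell {n : ℕ} {c : RelCWComplex.cell C n} {x : X}
    (hx : x ∈ RelCWComplex.openCell n c) {p : ℕ} :
    x ∈ CWComplex.skeletonLT C p ↔ n < p := by
  constructor
  · intro h
    by_contra hn
    refine (CWComplex.disjoint_skeletonLT_openCell (C := C) (j := c)
      (n := (p : ℕ∞)) ?_).notMem_of_mem_left h hx
    exact_mod_cast not_lt.1 hn
  · intro h
    refine CWComplex.skeletonLT_mono (m := (n : ℕ∞) + 1) ?_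
      (CWComplex.openCell_subset_skeletonLT n c hx)
    exact_mod_cast h

/-- A closed subset of a CW complex that contains every open cell which it meets is a
subcomplex. -/
def subcomplexOfIsClosed (S : Set X) (hS : IsClosed S) (hSC : S ⊆ C)
    (h : ∀ (n : ℕ) (c : RelCWComplex.cell C n),
      (RelCWComplex.openCell n c ∩ S).Nonempty → RelCWComplex.openCell n c ⊆ S) :
    CWComplex.Subcomplex C where
  carrier := S
  I n := {c | RelCWComplex.openCell n c ⊆ S}
  closed' := hS
  union' := by
    rw [empty_union]
    refine Subset.antisymm (iUnion₂_subset fun n c => c.2) fun x hx => ?_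
    have hxC := hSC hx
    rw [← CWComplex.iUnion_openCell_eq_complex (C := C)] at hxC
    obtain ⟨n, c, hc⟩ := mem_iUnion₂.1 hxC
    exact mem_iUnion₂.2 ⟨n, ⟨c, h n c ⟨x, hc, hx⟩⟩, hc⟩

/-- The union of two subcomplexes. -/
def subcomplexUnion (A B : CWComplex.Subcomplex C) : CWComplex.Subcomplex C :=
  subcomplexOfIsClosed (A ∪ B) (A.closed'.union B.closed')
    (union_subset (CWComplex.Subcomplex.subset_complex A)
      (CWComplex.Subcomplex.subset_complex B)) <| by
    rintro n c ⟨x, hx, hA | hB⟩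
    · exact (openCell_subset_iff.2 (mem_I_of_mem_openCell hx hA)).trans subset_union_left
    · exact (openCell_subset_iff.2 (mem_I_of_mem_openCell hx hB)).trans subset_union_right

@[simp]
lemma coe_subcomplexUnion (A B : CWComplex.Subcomplex C) :
    (subcomplexUnion A B : Set X) = (A : Set X) ∪ B := rfl

/-- The subcomplex `A ∪ c` for a cell `c` with boundary in the subcomplex `A`. -/
def insertCell (A : CWComplex.Subcomplex C) (n : ℕ) (c : RelCWComplex.cell C n)
    (h : RelCWComplex.cellFrontier n c ⊆ A) : CWComplex.Subcomplex C :=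
  subcomplexOfIsClosed (A ∪ RelCWComplex.openCell n c)
    (by
      have : (A : Set X) ∪ RelCWComplex.openCell n c = (A : Set X) ∪ RelCWComplex.closedCell n c := by
        rw [← CWComplex.cellFrontier_union_openCell_eq_closedCell, ← union_assoc,
          union_eq_self_of_subset_right h]
      rw [this]
      exact A.closed'.union CWComplex.isClosed_closedCell)
    (union_subset (CWComplex.Subcomplex.subset_complex A)
      (CWComplex.openCell_subset_complex n c)) <| by
    rintro k c' ⟨x, hx, hA | hB⟩
    · exact (openCell_subset_iff.2 (mem_I_of_mem_openCell hx hA)).trans subset_union_left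
    · obtain h := CWComplex.eq_of_not_disjoint_openCell (not_disjoint_iff.2 ⟨x, hx, hB⟩)
      cases h
      exact subset_union_right

lemma DimLE.insertCell {A : CWComplex.Subcomplex C} {n p : ℕ} {c : RelCWComplex.cell C n}
    {h : RelCWComplex.cellFrontier n c ⊆ A} (hA : DimLE A p) (hn : n ≤ p) :
    DimLE (insertCell A n c h) p := by
  intro k hk
  refine eq_empty_of_forall_notMem fun c' hc' => ?_
  obtain ⟨x, hx⟩ := RelCWComplex.openCell_nonempty k c'
  rcases (openCell_subset_iff.2 hc') hx with hA' | hc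
  · have := mem_I_of_mem_openCell hx hA'
    rw [hA k hk] at this
    exact this
  · have h := CWComplex.eq_of_not_disjoint_openCell (not_disjoint_iff.2 ⟨x, hx, hc⟩)
    cases h
    omega

/-- The boundary of the attached cell lies in the smaller subcomplex. -/
lemma IsCellAttachment.cellFrontier_subset {A B : CWComplex.Subcomplex C} {n : ℕ}
    {c : RelCWComplex.cell C n} (h : IsCellAttachment A B n c) :
    RelCWComplex.cellFrontier n c ⊆ A := by
  intro x hx
  have hcB : c ∈ B.I n := openCell_subset_iff.1 (h.2 ▸ subset_union_right)
  have hxB : x ∈ (B : Set X) := CWComplex.Subcomplex.cellFrontier_subset_of_mem B hcB hx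
  rw [h.2] at hxB
  refine hxB.resolve_right fun hxc => ?_
  have := CWComplex.cellFrontier_subset_skeletonLT n c hx
  exact lt_irrefl _ ((mem_skeletonLT_iff_of_mem_openCell hxc).1 this)

lemma isCharMap_map (n : ℕ) (c : RelCWComplex.cell C n) :
    IsCharMap n c (RelCWComplex.map n c) where
  continuousOn := RelCWComplex.continuousOn n c
  injOn := by
    have := (RelCWComplex.map n c).injOn
    rwa [RelCWComplex.source_eq] at this
  image_eq := rfl
  mapsTo := fun x hx => CWComplex.cellFrontier_subset_skeletonLT n c (mem_image_of_mem _ hx)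

lemma IsCharMap.congr {n : ℕ} {c : RelCWComplex.cell C n} {f g : (Fin n → ℝ) → X}
    (hf : IsCharMap n c f) (h : EqOn g f (closedBall 0 1)) : IsCharMap n c g where
  continuousOn := hf.continuousOn.congr h
  injOn := hf.injOn.congr (h.mono ball_subset_closedBall).symm
  image_eq := (h.mono ball_subset_closedBall).image_eq.trans hf.image_eq
  mapsTo := hf.mapsTo.congr (h.mono sphere_subset_closedBall).symm

end Subcomplex

/-! ### Inclusions of CW complexes -/

namespace CellularInclusion

variable {X Y Z : Type u} [TopologicalSpace X] [TopologicalSpace Y] [TopologicalSpace Z]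
  [CWComplex (univ : Set X)] [CWComplex (univ : Set Y)] [CWComplex (univ : Set Z)]

lemma injective (ι : CellularInclusion X Y) : Function.Injective ι.toFun :=
  ι.isClosedEmbedding.injective

lemma openCell_cellMap (ι : CellularInclusion X Y) (n : ℕ)
    (c : RelCWComplex.cell (univ : Set X) n) :
    RelCWComplex.openCell n (ι.cellMap n c) = ι.toFun '' RelCWComplex.openCell n c := by
  unfold RelCWComplex.openCell
  rw [image_image]
  exact image_congr fun x hx => (ι.map_eq n c x (ball_subset_closedBall hx)).symm

lemma cellFrontier_cellMap (ι : CellularInclusion X Y) (n : ℕ)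
    (c : RelCWComplex.cell (univ : Set X) n) :
    RelCWComplex.cellFrontier n (ι.cellMap n c) = ι.toFun '' RelCWComplex.cellFrontier n c := by
  unfold RelCWComplex.cellFrontier
  rw [image_image]
  exact image_congr fun x hx => (ι.map_eq n c x (sphere_subset_closedBall hx)).symm

@[simp]
lemma coe_image (ι : CellularInclusion X Y) (A : CWComplex.Subcomplex (univ : Set X)) :
    (ι.image A : Set Y) = ι.toFun '' A := rfl

/-- A CW complex as a subcomplex of itself. -/
protected def id (X : Type u) [TopologicalSpace X] [CWComplex (univ : Set X)] :
    CellularInclusion X X where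
  toFun := id
  cellMap _ := id
  isClosedEmbedding := IsClosedEmbedding.id
  map_eq _ _ _ _ := rfl

/-- The composition of two inclusions as a subcomplex. -/
protected def comp (κ : CellularInclusion Y Z) (ι : CellularInclusion X Y) :
    CellularInclusion X Z where
  toFun := κ.toFun ∘ ι.toFun
  cellMap n := κ.cellMap n ∘ ι.cellMap n
  isClosedEmbedding := κ.isClosedEmbedding.comp ι.isClosedEmbedding
  map_eq n c x hx := by
    simp only [Function.comp_apply, ι.map_eq n c x hx, κ.map_eq n _ x hx]

@[simp]
lemma id_image (A : CWComplex.Subcomplex (univ : Set X)) :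
    (CellularInclusion.id X).image A = A :=
  SetLike.coe_injective (image_id _)

lemma comp_image (κ : CellularInclusion Y Z) (ι : CellularInclusion X Y)
    (A : CWComplex.Subcomplex (univ : Set X)) : (κ.comp ι).image A = κ.image (ι.image A) :=
  SetLike.coe_injective (image_comp κ.toFun ι.toFun A)

lemma image_mono (ι : CellularInclusion X Y) {A B : CWComplex.Subcomplex (univ : Set X)}
    (h : A ≤ B) : ι.image A ≤ ι.image B :=
  Set.image_mono h

lemma dimLE_image (ι : CellularInclusion X Y) {A : CWComplex.Subcomplex (univ : Set X)} {n : ℕ}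
    (h : DimLE A n) : DimLE (ι.image A) n := by
  intro k hk
  change ι.cellMap k '' A.I k = ∅
  rw [h k hk, image_empty]

/-- The push-forward of a self-map along an inclusion; it is the identity off the image. -/
def pushMap (ι : CellularInclusion X Y) (r : X → X) : Y → Y :=
  Function.extend ι.toFun (ι.toFun ∘ r) id

lemma pushMap_apply (ι : CellularInclusion X Y) (r : X → X) (x : X) :
    ι.pushMap r (ι.toFun x) = ι.toFun (r x) :=
  ι.injective.extend_apply _ _ _

variable [T2Space X] [T2Space Y]

lemma map_mem_skeletonLT (ι : CellularInclusion X Y) {p : ℕ∞} {x : X}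
    (hx : x ∈ CWComplex.skeletonLT (univ : Set X) p) :
    ι.toFun x ∈ CWComplex.skeletonLT (univ : Set Y) p := by
  obtain ⟨n, hn, c, hc⟩ := CWComplex.mem_skeletonLT_iff.1 hx
  exact CWComplex.mem_skeletonLT_iff.2
    ⟨n, hn, ι.cellMap n c, ι.openCell_cellMap n c ▸ mem_image_of_mem _ hc⟩

lemma cellMap_mem_image_iff (ι : CellularInclusion X Y) {A : CWComplex.Subcomplex (univ : Set X)}
    {n : ℕ} {c : RelCWComplex.cell (univ : Set X) n} :
    ι.cellMap n c ∈ (ι.image A).I n ↔ c ∈ A.I n := by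
  rw [← openCell_subset_iff, ← openCell_subset_iff, ι.openCell_cellMap, coe_image,
    image_subset_image_iff ι.injective]

lemma isCharMap (ι : CellularInclusion X Y) {n : ℕ} {c : RelCWComplex.cell (univ : Set X) n}
    {ψ : (Fin n → ℝ) → X} (h : IsCharMap n c ψ) :
    IsCharMap n (ι.cellMap n c) (ι.toFun ∘ ψ) where
  continuousOn := ι.isClosedEmbedding.continuous.comp_continuousOn h.continuousOn
  injOn := ι.injective.comp_injOn h.injOn
  image_eq := by rw [image_comp, h.image_eq, ι.openCell_cellMap]
  mapsTo := fun _ hx => ι.map_mem_skeletonLT (h.mapsTo hx)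

lemma isCellAttachment (ι : CellularInclusion X Y) {A B : CWComplex.Subcomplex (univ : Set X)}
    {n : ℕ} {c : RelCWComplex.cell (univ : Set X) n} (h : IsCellAttachment A B n c) :
    IsCellAttachment (ι.image A) (ι.image B) n (ι.cellMap n c) := by
  refine ⟨fun hc => h.1 (ι.cellMap_mem_image_iff.1 hc), ?_⟩
  rw [coe_image, h.2, image_union, ι.openCell_cellMap, coe_image]

lemma elementaryCollapsesVia (ι : CellularInclusion X Y)
    {K L : CWComplex.Subcomplex (univ : Set X)} {r : X → X} (h : ElementaryCollapsesVia K L r) :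
    ElementaryCollapsesVia (ι.image K) (ι.image L) (ι.pushMap r) := by
  obtain ⟨k, a, b, ψ, ha, hb, hK, hψ, hψa, hbase, hrL, hr⟩ := h
  refine ⟨k, ι.cellMap k a, ι.cellMap (k + 1) b, ι.toFun ∘ ψ,
    fun h => ha (ι.cellMap_mem_image_iff.1 h), fun h => hb (ι.cellMap_mem_image_iff.1 h),
    ?_, ι.isCharMap hψ, ι.isCharMap hψa, ?_, ?_, ?_⟩
  · rw [coe_image, hK, image_union, image_union, ι.openCell_cellMap, ι.openCell_cellMap, coe_image]
  · exact fun x hx => ⟨mem_image_of_mem _ (hbase hx).1, ι.map_mem_skeletonLT (hbase hx).2⟩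
  · rintro _ ⟨x, hx, rfl⟩
    rw [pushMap_apply, hrL hx, id, id]
  · intro x hx
    simp only [Function.comp_apply, pushMap_apply, hr x hx]

lemma collapsesVia (ι : CellularInclusion X Y)
    {K L : CWComplex.Subcomplex (univ : Set X)} {r : X → X} (h : CollapsesVia K L r) :
    CollapsesVia (ι.image K) (ι.image L) (ι.pushMap r) := by
  induction h with
  | refl K r hr =>
    refine .refl _ _ ?_
    rintro _ ⟨x, hx, rfl⟩
    rw [pushMap_apply, hr hx, id, id]
  | step K K' L r₁ r₂ r h₁ h₂ hr ih =>
    refine .step _ _ _ _ _ _ (ι.elementaryCollapsesVia h₁) ih ?_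
    rintro _ ⟨x, hx, rfl⟩
    rw [Function.comp_apply, pushMap_apply, pushMap_apply, pushMap_apply, hr hx,
      Function.comp_apply]

end CellularInclusion

/-! ### The cube and its standard retraction -/

section Cube

variable {k : ℕ}

/-- All coordinates of a point of `ℝ^{k+1}` but the last one. -/
def horiz (x : Fin (k + 1) → ℝ) : Fin k → ℝ := fun i => x i.castSucc

@[simp]
lemma horiz_snoc (y : Fin k → ℝ) (t : ℝ) : horiz (Fin.snoc (α := fun _ => ℝ) y t) = y := by
  funext i
  simp [horiz]

@[simp]
lemma snoc_horiz (x : Fin (k + 1) → ℝ) :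
    Fin.snoc (α := fun _ => ℝ) (horiz x) (x (Fin.last k)) = x :=
  Fin.snoc_init_self (α := fun _ => ℝ) x

lemma continuous_horiz : Continuous (horiz (k := k)) := by
  unfold horiz
  fun_prop

lemma norm_eq_max (x : Fin (k + 1) → ℝ) : ‖x‖ = max ‖horiz x‖ |x (Fin.last k)| := by
  refine le_antisymm ((pi_norm_le_iff_of_nonneg (le_max_of_le_left (norm_nonneg _))).2 fun i => ?_)
    (max_le ((pi_norm_le_iff_of_nonneg (norm_nonneg _)).2 fun i => norm_le_pi_norm x i.castSucc)
      (norm_le_pi_norm x (Fin.last k)))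
  induction i using Fin.lastCases with
  | last => exact le_max_right _ _
  | cast i => exact (norm_le_pi_norm (horiz x) i).trans (le_max_left _ _)

lemma norm_snoc (y : Fin k → ℝ) (t : ℝ) :
    ‖(Fin.snoc (α := fun _ => ℝ) y t : Fin (k + 1) → ℝ)‖ = max ‖y‖ |t| := by
  rw [norm_eq_max, horiz_snoc, Fin.snoc_last]

lemma mem_closedBall_iff_horiz {x : Fin (k + 1) → ℝ} :
    x ∈ closedBall (0 : Fin (k + 1) → ℝ) 1 ↔ ‖horiz x‖ ≤ 1 ∧ |x (Fin.last k)| ≤ 1 := by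
  rw [mem_closedBall_zero_iff, norm_eq_max, max_le_iff]

lemma mem_baseFace_iff {x : Fin (k + 1) → ℝ} :
    x ∈ baseFace k ↔
      x ∈ closedBall (0 : Fin (k + 1) → ℝ) 1 ∧ (x (Fin.last k) = -1 ∨ ‖horiz x‖ = 1) := by
  constructor
  · have hcl : IsClosed {x : Fin (k + 1) → ℝ | x ∈ closedBall (0 : Fin (k + 1) → ℝ) 1 ∧
        (x (Fin.last k) = -1 ∨ ‖horiz x‖ = 1)} :=
      isClosed_closedBall.inter ((isClosed_eq (continuous_apply _) continuous_const).union
        (isClosed_eq continuous_horiz.norm continuous_const))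
    refine fun hx => closure_minimal ?_ hcl hx
    rintro x ⟨hx, h1⟩
    refine ⟨sphere_subset_closedBall hx, ?_⟩
    rw [mem_sphere_zero_iff_norm, norm_eq_max] at hx
    rcases max_choice ‖horiz x‖ |x (Fin.last k)| with h | h
    · exact Or.inr (h ▸ hx)
    · rw [h] at hx
      exact Or.inl ((eq_or_eq_neg_of_abs_eq hx).resolve_left h1)
  · rintro ⟨hx, h⟩
    by_cases h1 : x (Fin.last k) = 1
    · -- a point of the rim of the free face is a limit of points on the vertical side below it
      have hy : ‖horiz x‖ = 1 := by
        rcases h with h | h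
        · linarith
        · exact h
      have hlim : Filter.Tendsto (fun t : ℝ => (Fin.snoc (α := fun _ => ℝ) (horiz x) t :
          Fin (k + 1) → ℝ)) (𝓝[<] 1) (𝓝 x) := by
        have hc : Continuous (fun t : ℝ => (Fin.snoc (α := fun _ => ℝ) (horiz x) t :
            Fin (k + 1) → ℝ)) := continuous_const.finSnoc continuous_id
        have := (hc.tendsto 1).mono_left (nhdsWithin_le_nhds (s := Iio 1))
        rwa [← h1, snoc_horiz, h1] at this
      refine mem_closure_of_tendsto hlim ?_
      have : Ioo (0 : ℝ) 1 ∈ 𝓝[<] (1 : ℝ) := Ioo_mem_nhdsLT one_pos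
      filter_upwards [this] with t ht
      refine ⟨?_, ?_⟩
      · rw [mem_sphere_zero_iff_norm, norm_snoc, hy, abs_of_pos ht.1, max_eq_left ht.2.le]
      · simpa using ht.2.ne
    · refine subset_closure ⟨?_, h1⟩
      rw [mem_closedBall_iff_horiz] at hx
      rw [mem_sphere_zero_iff_norm, norm_eq_max]
      rcases h with h | h
      · rw [h, abs_neg, abs_one, max_eq_right hx.1]
      · rw [h, max_eq_left hx.2]

lemma baseFace_subset_sphere : baseFace k ⊆ sphere 0 1 :=
  closure_minimal sdiff_subset isClosed_sphere

lemma baseFace_subset_closedBall : baseFace k ⊆ closedBall 0 1 :=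
  baseFace_subset_sphere.trans sphere_subset_closedBall

lemma freeFace_mem_closedBall {y : Fin k → ℝ} (hy : y ∈ closedBall 0 1) :
    freeFace k y ∈ closedBall (0 : Fin (k + 1) → ℝ) 1 := by
  rw [mem_closedBall_iff_horiz, freeFace, horiz_snoc, Fin.snoc_last, abs_one]
  exact ⟨mem_closedBall_zero_iff.1 hy, le_rfl⟩

/-- A point of the cube is an interior point, lies in the interior of the free face, or lies on the
base. -/
lemma mem_ball_or_freeFace_or_baseFace {x : Fin (k + 1) → ℝ} (hx : x ∈ closedBall 0 1) :
    x ∈ ball (0 : Fin (k + 1) → ℝ) 1 ∨ (∃ y ∈ ball (0 : Fin k → ℝ) 1, freeFace k y = x) ∨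
      x ∈ baseFace k := by
  rw [mem_baseFace_iff, mem_ball_zero_iff, norm_eq_max, max_lt_iff]
  have h := mem_closedBall_iff_horiz.1 hx
  rcases h.1.lt_or_eq with h1 | h1
  · rcases h.2.lt_or_eq with h2 | h2
    · exact Or.inl ⟨h1, h2⟩
    · rcases eq_or_eq_neg_of_abs_eq h2 with h3 | h3
      · refine Or.inr (Or.inl ⟨horiz x, mem_ball_zero_iff.2 h1, ?_⟩)
        rw [freeFace, ← h3, snoc_horiz]
      · exact Or.inr (Or.inr ⟨hx, Or.inl h3⟩)
  · exact Or.inr (Or.inr ⟨hx, Or.inr h1⟩)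

lemma discRetraction_eq (x : Fin (k + 1) → ℝ) :
    discRetraction k x = Fin.snoc (α := fun _ => ℝ)
      ((max ‖horiz x‖ ((3 - x (Fin.last k)) / 4))⁻¹ • horiz x)
      (3 - (max ‖horiz x‖ ((3 - x (Fin.last k)) / 4))⁻¹ * (3 - x (Fin.last k))) := rfl

lemma discRetraction_mem_baseFace {x : Fin (k + 1) → ℝ} (hx : x ∈ closedBall 0 1) :
    discRetraction k x ∈ baseFace k := by
  obtain ⟨hy, ht⟩ := mem_closedBall_iff_horiz.1 hx
  have ht' := abs_le.1 ht
  rw [mem_baseFace_iff, mem_closedBall_iff_horiz, discRetraction_eq, horiz_snoc, Fin.snoc_last,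
    norm_smul]
  set t := x (Fin.last k)
  set M := max ‖horiz x‖ ((3 - t) / 4) with hM
  have h1 : ‖horiz x‖ ≤ M := le_max_left _ _
  have h2 : (3 - t) / 4 ≤ M := le_max_right _ _
  have h3 : M ≤ (3 - t) / 2 := max_le (by linarith) (by linarith)
  have hpos : 0 < M := by linarith
  rw [Real.norm_of_nonneg (inv_nonneg.2 hpos.le), inv_mul_eq_div, inv_mul_eq_div]
  have h4 : (3 - t) / M ≤ 4 := by rw [div_le_iff₀ hpos]; linarith
  have h5 : 2 ≤ (3 - t) / M := by rw [le_div_iff₀ hpos]; linarith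
  refine ⟨⟨(div_le_one hpos).2 h1, abs_le.2 ⟨by linarith, by linarith⟩⟩, ?_⟩
  rcases max_choice ‖horiz x‖ ((3 - t) / 4) with h | h
  · right
    rw [← hM] at h
    rw [← h, div_self hpos.ne']
  · left
    rw [← hM] at h
    have : 3 - t = 4 * M := by rw [h]; ring
    rw [this, mul_div_assoc, div_self hpos.ne']
    norm_num

lemma discRetraction_eq_self {x : Fin (k + 1) → ℝ} (hx : x ∈ baseFace k) :
    discRetraction k x = x := by
  obtain ⟨hx, h⟩ := mem_baseFace_iff.1 hx
  obtain ⟨hy, ht⟩ := mem_closedBall_iff_horiz.1 hx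
  have ht' := abs_le.1 ht
  have hM : max ‖horiz x‖ ((3 - x (Fin.last k)) / 4) = 1 := by
    rcases h with h | h
    · rw [h, max_eq_right] <;> linarith
    · rw [h, max_eq_left]; linarith
  rw [discRetraction_eq, hM, inv_one, one_smul, one_mul, sub_sub_cancel, snoc_horiz]

lemma continuousOn_discRetraction : ContinuousOn (discRetraction k) (closedBall 0 1) := by
  have hM : Continuous fun x : Fin (k + 1) → ℝ =>
      max ‖horiz x‖ ((3 - x (Fin.last k)) / 4) := by
    have := continuous_horiz (k := k)
    fun_prop
  have hinv : ContinuousOn (fun x : Fin (k + 1) → ℝ =>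
      (max ‖horiz x‖ ((3 - x (Fin.last k)) / 4))⁻¹) (closedBall 0 1) := by
    refine hM.continuousOn.inv₀ fun x hx => ?_
    have ht := abs_le.1 (mem_closedBall_iff_horiz.1 hx).2
    exact (lt_max_of_lt_right (by linarith)).ne'
  refine ContinuousOn.congr ?_ fun x _ => discRetraction_eq x
  refine ContinuousOn.finSnoc (hinv.smul continuous_horiz.continuousOn) ?_
  exact continuousOn_const.sub (hinv.mul (by fun_prop))

/-- The reflection of the cube in the last coordinate. -/
def reflect (x : Fin (k + 1) → ℝ) : Fin (k + 1) → ℝ :=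
  Fin.snoc (α := fun _ => ℝ) (horiz x) (-x (Fin.last k))

@[simp]
lemma horiz_reflect (x : Fin (k + 1) → ℝ) : horiz (reflect x) = horiz x := horiz_snoc _ _

@[simp]
lemma reflect_last (x : Fin (k + 1) → ℝ) : reflect x (Fin.last k) = -x (Fin.last k) := by
  simp [reflect]

lemma reflect_reflect (x : Fin (k + 1) → ℝ) : reflect (reflect x) = x := by
  conv_rhs => rw [← snoc_horiz x]
  rw [reflect, horiz_reflect, reflect_last, neg_neg]

lemma norm_reflect (x : Fin (k + 1) → ℝ) : ‖reflect x‖ = ‖x‖ := by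
  rw [norm_eq_max, horiz_reflect, reflect_last, abs_neg, ← norm_eq_max]

lemma continuous_reflect : Continuous (reflect (k := k)) :=
  continuous_horiz.finSnoc (continuous_apply _).neg

lemma IsCharMap.comp_reflect {X : Type u} [TopologicalSpace X] [T2Space X] {C : Set X} [CWComplex C]
    {c : RelCWComplex.cell C (k + 1)} {ψ : (Fin (k + 1) → ℝ) → X} (h : IsCharMap (k + 1) c ψ) :
    IsCharMap (k + 1) c (ψ ∘ reflect) where
  continuousOn := h.continuousOn.comp continuous_reflect.continuousOn fun x hx => by
    rwa [mem_closedBall_zero_iff, norm_reflect, ← mem_closedBall_zero_iff]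
  injOn := h.injOn.comp (Function.LeftInverse.injective reflect_reflect).injOn fun x hx => by
    rwa [mem_ball_zero_iff, norm_reflect, ← mem_ball_zero_iff]
  image_eq := by
    rw [image_comp, ← h.image_eq]
    congr 1
    refine Subset.antisymm ?_ fun x hx => ⟨reflect x, ?_, reflect_reflect x⟩
    · rintro _ ⟨x, hx, rfl⟩
      rwa [mem_ball_zero_iff, norm_reflect, ← mem_ball_zero_iff]
    · rwa [mem_ball_zero_iff, norm_reflect, ← mem_ball_zero_iff]
  mapsTo := h.mapsTo.comp fun x hx => by
    rwa [mem_sphere_zero_iff_norm, norm_reflect, ← mem_sphere_zero_iff_norm]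

end Cube

/-! ### Elementary collapses -/

section Collapse

variable {X : Type u} [TopologicalSpace X] [T2Space X] {C : Set X} [CWComplex C]

/-- The part of the data of an elementary collapse of `L ∪ a ∪ b` to `L` that does not involve the
retraction. -/
structure IsCollapsePair (L : CWComplex.Subcomplex C) (k : ℕ) (a : RelCWComplex.cell C k)
    (b : RelCWComplex.cell C (k + 1)) (ψ : (Fin (k + 1) → ℝ) → X) : Prop where
  notMem_a : a ∉ L.I k
  notMem_b : b ∉ L.I (k + 1)
  isCharMap : IsCharMap (k + 1) b ψ
  isCharMap_freeFace : IsCharMap k a (fun y => ψ (freeFace k y))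
  mapsTo_baseFace : MapsTo ψ (baseFace k) ((L : Set X) ∩ (CWComplex.skeleton C k : Set X))

namespace IsCollapsePair

variable {L : CWComplex.Subcomplex C} {k : ℕ} {a : RelCWComplex.cell C k}
  {b : RelCWComplex.cell C (k + 1)} {ψ : (Fin (k + 1) → ℝ) → X}

lemma map_mem_b (h : IsCollapsePair L k a b ψ) {u : Fin (k + 1) → ℝ} (hu : u ∈ ball 0 1) :
    ψ u ∈ RelCWComplex.openCell (k + 1) b :=
  h.isCharMap.image_eq ▸ mem_image_of_mem ψ hu

lemma map_mem_a (h : IsCollapsePair L k a b ψ) {y : Fin k → ℝ} (hy : y ∈ ball 0 1) :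
    ψ (freeFace k y) ∈ RelCWComplex.openCell k a :=
  h.isCharMap_freeFace.image_eq ▸ mem_image_of_mem (fun y => ψ (freeFace k y)) hy

lemma disjoint_a (h : IsCollapsePair L k a b ψ) : Disjoint (RelCWComplex.openCell k a) (L : Set X) :=
  CWComplex.Subcomplex.disjoint_openCell_subcomplex_of_not_mem L h.notMem_a

lemma disjoint_b (h : IsCollapsePair L k a b ψ) :
    Disjoint (RelCWComplex.openCell (k + 1) b) (L : Set X) :=
  CWComplex.Subcomplex.disjoint_openCell_subcomplex_of_not_mem L h.notMem_b

/-- The disc `D^{k+1}` maps onto the two removed cells and into the smaller complex. -/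
lemma union_image (h : IsCollapsePair L k a b ψ) :
    (L : Set X) ∪ RelCWComplex.openCell k a ∪ RelCWComplex.openCell (k + 1) b =
      (L : Set X) ∪ ψ '' closedBall 0 1 := by
  apply Subset.antisymm
  · rw [← h.isCharMap.image_eq, ← h.isCharMap_freeFace.image_eq]
    refine union_subset (union_subset subset_union_left ?_) ?_
    · rintro _ ⟨y, hy, rfl⟩
      exact Or.inr (mem_image_of_mem _ (freeFace_mem_closedBall (ball_subset_closedBall hy)))
    · exact (image_mono ball_subset_closedBall).trans subset_union_right
  · refine union_subset (subset_union_left.trans subset_union_left) ?_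
    rintro _ ⟨u, hu, rfl⟩
    rcases mem_ball_or_freeFace_or_baseFace hu with hu | ⟨y, hy, rfl⟩ | hu
    · exact Or.inr (h.map_mem_b hu)
    · exact Or.inl (Or.inr (h.map_mem_a hy))
    · exact Or.inl (Or.inl (h.mapsTo_baseFace hu).1)

lemma image_subset_skeletonLT (h : IsCollapsePair L k a b ψ) {u : Fin (k + 1) → ℝ}
    (hu : u ∈ closedBall 0 1) : ψ u ∈ CWComplex.skeletonLT C ((k + 2 : ℕ) : ℕ∞) := by
  rcases (mem_closedBall_zero_iff.1 hu).lt_or_eq with hu | hu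
  · exact (mem_skeletonLT_iff_of_mem_openCell (h.map_mem_b (mem_ball_zero_iff.2 hu))).2 (by omega)
  · refine CWComplex.skeletonLT_mono (m := ((k + 1 : ℕ) : ℕ∞)) ?_
      (h.isCharMap.mapsTo (mem_sphere_zero_iff_norm.2 hu))
    exact_mod_cast (by omega : k + 1 ≤ k + 2)

/-- Functions on `L` and on `D^{k+1}` that agree on the base have a common extension to the larger
complex: `ψ` maps the complement of the base injectively into the complement of `L`. -/
lemma exists_extension (h : IsCollapsePair L k a b ψ) {Z : Type*} (g : X → Z)
    (f : (Fin (k + 1) → ℝ) → Z) (hfg : ∀ u ∈ baseFace k, f u = g (ψ u)) :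
    ∃ F : X → Z, EqOn F g L ∧ ∀ u ∈ closedBall 0 1, F (ψ u) = f u := by
  classical
  refine ⟨fun x => if hx : x ∉ L ∧ ∃ u ∈ closedBall 0 1, ψ u = x then f hx.2.choose else g x,
    fun x hx => dif_neg fun h' => h'.1 hx, fun u hu => ?_⟩
  dsimp only
  by_cases hL : ψ u ∈ L
  · rw [dif_neg fun h' : ψ u ∉ L ∧ _ => h'.1 hL]
    rcases mem_ball_or_freeFace_or_baseFace hu with hu | ⟨y, hy, rfl⟩ | hu
    · exact (h.disjoint_b.notMem_of_mem_left (h.map_mem_b hu) hL).elim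
    · exact (h.disjoint_a.notMem_of_mem_left (h.map_mem_a hy) hL).elim
    · exact (hfg u hu).symm
  · have hex : ψ u ∉ L ∧ ∃ v ∈ closedBall 0 1, ψ v = ψ u := ⟨hL, u, hu, rfl⟩
    rw [dif_pos hex]
    congr 1
    obtain ⟨hv, hvu⟩ := hex.2.choose_spec
    generalize hex.2.choose = v at hv hvu
    rcases mem_ball_or_freeFace_or_baseFace hu with hu | ⟨y, hy, rfl⟩ | hu
    · rcases mem_ball_or_freeFace_or_baseFace hv with hv | ⟨z, hz, rfl⟩ | hv
      · exact h.isCharMap.injOn hv hu hvu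
      · exact (disjoint_openCell_succ.notMem_of_mem_left (h.map_mem_a hz) (hvu ▸ h.map_mem_b hu)).elim
      · exact (hL (hvu ▸ (h.mapsTo_baseFace hv).1)).elim
    · rcases mem_ball_or_freeFace_or_baseFace hv with hv | ⟨z, hz, rfl⟩ | hv
      · exact (disjoint_openCell_succ.notMem_of_mem_left (hvu ▸ h.map_mem_a hy) (h.map_mem_b hv)).elim
      · rw [h.isCharMap_freeFace.injOn hz hy hvu]
      · exact (hL (hvu ▸ (h.mapsTo_baseFace hv).1)).elim
    · exact (hL (h.mapsTo_baseFace hu).1).elim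

/-- The canonical retraction of an elementary collapse exists. -/
lemma exists_elementaryCollapsesVia (h : IsCollapsePair L k a b ψ) {K : CWComplex.Subcomplex C}
    (hK : (K : Set X) =
      (L : Set X) ∪ RelCWComplex.openCell k a ∪ RelCWComplex.openCell (k + 1) b) :
    ∃ r, ElementaryCollapsesVia K L r := by
  obtain ⟨r, hrL, hr⟩ := h.exists_extension id (fun u => ψ (discRetraction k u)) fun u hu => by
    rw [discRetraction_eq_self hu, id]
  exact ⟨r, k, a, b, ψ, h.notMem_a, h.notMem_b, hK, h.isCharMap, h.isCharMap_freeFace,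
    h.mapsTo_baseFace, hrL, hr⟩

end IsCollapsePair

lemma ElementaryCollapsesVia.exists_isCollapsePair {K L : CWComplex.Subcomplex C} {r : X → X}
    (h : ElementaryCollapsesVia K L r) :
    ∃ k a b ψ, IsCollapsePair L k a b ψ ∧ (K : Set X) =
      (L : Set X) ∪ RelCWComplex.openCell k a ∪ RelCWComplex.openCell (k + 1) b ∧
      EqOn r id L ∧ ∀ x ∈ closedBall (0 : Fin (k + 1) → ℝ) 1, r (ψ x) = ψ (discRetraction k x) := by
  obtain ⟨k, a, b, ψ, ha, hb, hK, hψ, hψa, hbase, hrL, hr⟩ := h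
  exact ⟨k, a, b, ψ, ⟨ha, hb, hψ, hψa, hbase⟩, hK, hrL, hr⟩

/-- A continuous function on a compact set which factors through a continuous map to a Hausdorff
space factors through it continuously. -/
lemma continuousOn_image_of_comp {A B Z : Type*} [TopologicalSpace A] [TopologicalSpace B]
    [TopologicalSpace Z] [T2Space B] {S : Set A} {f : A → B} {g : B → Z} (hS : IsCompact S)
    (hf : ContinuousOn f S) (hgf : ContinuousOn (g ∘ f) S) : ContinuousOn g (f '' S) := by
  rw [continuousOn_iff_isClosed]
  intro t ht
  obtain ⟨u, hu, hut⟩ := continuousOn_iff_isClosed.1 hgf t ht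
  refine ⟨f '' (u ∩ S), ((hS.inter_left hu).image_of_continuousOn
    (hf.mono inter_subset_right)).isClosed, ?_⟩
  rw [← hut]
  ext y
  constructor
  · rintro ⟨hy, x, hx, rfl⟩
    exact ⟨⟨x, ⟨hy, hx⟩, rfl⟩, x, hx, rfl⟩
  · rintro ⟨⟨x, ⟨hx, hxS⟩, rfl⟩, -⟩
    exact ⟨hx, x, hxS, rfl⟩

/-- `H` is a strong deformation retraction of `K` onto `L` with end map `r`, and it is cellular: it
maps the product of each skeleton with the interval to the next skeleton, and `r` preserves the
skeleta. -/
structure IsCellularDeformation (K L : CWComplex.Subcomplex C) (r : X → X) (H : X × ℝ → X) :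
    Prop where
  subset : (L : Set X) ⊆ K
  mapsTo_end : MapsTo r (K : Set X) L
  continuousOn : ContinuousOn H ((K : Set X) ×ˢ Icc 0 1)
  mapsTo : MapsTo H ((K : Set X) ×ˢ Icc 0 1) K
  map_zero : ∀ x ∈ (K : Set X), H (x, 0) = x
  map_one : ∀ x ∈ (K : Set X), H (x, 1) = r x
  map_of_mem : ∀ x ∈ (L : Set X), ∀ t ∈ Icc (0 : ℝ) 1, H (x, t) = x
  map_mem_skeletonLT : ∀ p : ℕ, ∀ x ∈ (K : Set X), x ∈ CWComplex.skeletonLT C p →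
    ∀ t ∈ Icc (0 : ℝ) 1, H (x, t) ∈ CWComplex.skeletonLT C ((p + 1 : ℕ) : ℕ∞)
  end_mem_skeletonLT : ∀ p : ℕ, ∀ x ∈ (K : Set X), x ∈ CWComplex.skeletonLT C p →
    r x ∈ CWComplex.skeletonLT C p

lemma IsCellularDeformation.isStrongDeformationRetraction {K L : CWComplex.Subcomplex C}
    {r : X → X} {H : X × ℝ → X} (h : IsCellularDeformation K L r H) :
    IsStrongDeformationRetraction (K : Set X) (L : Set X) r :=
  ⟨h.subset, h.mapsTo_end, H, h.continuousOn, h.mapsTo, h.map_zero, h.map_one, h.map_of_mem⟩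

lemma IsCellularDeformation.continuousOn_end {K L : CWComplex.Subcomplex C}
    {r : X → X} {H : X × ℝ → X} (h : IsCellularDeformation K L r H) : ContinuousOn r (K : Set X) := by
  have : ContinuousOn (fun x : X => H (x, 1)) (K : Set X) :=
    h.continuousOn.comp (by fun_prop) fun x hx => ⟨hx, by simp⟩
  exact this.congr fun x hx => (h.map_one x hx).symm

lemma ElementaryCollapsesVia.exists_isCellularDeformation {K L : CWComplex.Subcomplex C}
    {r : X → X} (h : ElementaryCollapsesVia K L r) : ∃ H, IsCellularDeformation K L r H := by
  obtain ⟨k, a, b, ψ, hp, hK, hrL, hr⟩ := h.exists_isCollapsePair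
  have hK' := hK.trans hp.union_image
  have hLK : (L : Set X) ⊆ K := hK' ▸ subset_union_left
  -- the homotopy is induced by the straight-line homotopy from the identity of the disc to its
  -- standard retraction
  let w : (Fin (k + 1) → ℝ) × ℝ → (Fin (k + 1) → ℝ) := fun p =>
    (1 - p.2) • p.1 + p.2 • discRetraction k p.1
  have hw : MapsTo w (closedBall 0 1 ×ˢ Icc 0 1) (closedBall 0 1) := fun p hp =>
    convex_closedBall (0 : Fin (k + 1) → ℝ) 1 hp.1
      (baseFace_subset_closedBall (discRetraction_mem_baseFace hp.1))
      (sub_nonneg.2 hp.2.2) hp.2.1 (by ring)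
  have hwc : ContinuousOn w (closedBall 0 1 ×ˢ Icc 0 1) := by
    have h1 : ContinuousOn (fun p : (Fin (k + 1) → ℝ) × ℝ => discRetraction k p.1)
        (closedBall 0 1 ×ˢ Icc 0 1) :=
      continuousOn_discRetraction.comp continuousOn_fst fun p hp => hp.1
    have h2 : ContinuousOn (fun p : (Fin (k + 1) → ℝ) × ℝ => (1 - p.2) • p.1)
        (closedBall 0 1 ×ˢ Icc 0 1) := by fun_prop
    exact h2.add (continuousOn_snd.smul h1)
  obtain ⟨F, hFL, hF⟩ := hp.exists_extension (fun x (_ : ℝ) => x) (fun u t => ψ (w (u, t)))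
    fun u hu => by
      funext t
      simp only [w, discRetraction_eq_self hu, ← add_smul, sub_add_cancel, one_smul]
  have hF' : ∀ u ∈ closedBall 0 1, ∀ t, F (ψ u) t = ψ (w (u, t)) := fun u hu t => by rw [hF u hu]
  have hFL' : ∀ x ∈ (L : Set X), ∀ t, F x t = x := fun x hx t => by rw [hFL hx]
  have hcases : ∀ x ∈ (K : Set X), x ∈ (L : Set X) ∨ ∃ u ∈ closedBall 0 1, ψ u = x := by
    intro x hx
    rwa [hK'] at hx
  have hψK : ∀ u ∈ closedBall 0 1, ψ u ∈ (K : Set X) := fun u hu =>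
    hK' ▸ Or.inr (mem_image_of_mem ψ hu)
  have hskel : ∀ p : ℕ, ∀ x ∈ (K : Set X), x ∈ CWComplex.skeletonLT C p → x ∉ (L : Set X) →
      k + 1 ≤ p := by
    intro p x hx hxp hxL
    rw [hK] at hx
    rcases hx with (hx | hx) | hx
    · exact (hxL hx).elim
    · exact (mem_skeletonLT_iff_of_mem_openCell hx).1 hxp
    · exact ((mem_skeletonLT_iff_of_mem_openCell hx).1 hxp).le
  refine ⟨fun p => F p.1 p.2, hLK, ?_, ?_, ?_, ?_, ?_, ?_, ?_, ?_⟩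
  · intro x hx
    rcases hcases x hx with hx | ⟨u, hu, rfl⟩
    · rw [hrL hx]; exact hx
    · rw [hr u hu]
      exact (hp.mapsTo_baseFace (discRetraction_mem_baseFace hu)).1
  · rw [hK', union_prod]
    have himage : (ψ '' closedBall 0 1) ×ˢ Icc (0 : ℝ) 1 =
        Prod.map ψ id '' (closedBall 0 1 ×ˢ Icc (0 : ℝ) 1) := by
      rw [prodMap_image_prod, image_id]
    refine ContinuousOn.union_of_isClosed ?_ ?_ (L.closed'.prod isClosed_Icc)
      (((isCompact_closedBall 0 1).image_of_continuousOn
        hp.isCharMap.continuousOn).isClosed.prod isClosed_Icc)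
    · exact continuousOn_fst.congr fun p hp => hFL' p.1 hp.1 p.2
    · rw [himage]
      refine continuousOn_image_of_comp ((isCompact_closedBall 0 1).prod isCompact_Icc)
        (hp.isCharMap.continuousOn.prodMap continuousOn_id) ?_
      exact (hp.isCharMap.continuousOn.comp hwc hw).congr fun p hp => hF' p.1 hp.1 p.2
  · rintro ⟨x, t⟩ ⟨hx, ht⟩
    rcases hcases x hx with hx | ⟨u, hu, rfl⟩
    · simpa only [hFL' x hx t] using hLK hx
    · simpa only [hF' u hu t] using hψK _ (hw ⟨hu, ht⟩)
  · intro x hx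
    rcases hcases x hx with hx | ⟨u, hu, rfl⟩
    · exact hFL' x hx 0
    · simp only [hF' u hu, w, sub_zero, one_smul, zero_smul, add_zero]
  · intro x hx
    rcases hcases x hx with hx | ⟨u, hu, rfl⟩
    · simp only [hFL' x hx, hrL hx, id]
    · simp only [hF' u hu, w, sub_self, one_smul, zero_smul, zero_add, hr u hu]
  · exact fun x hx t _ => hFL' x hx t
  · intro p x hx hxp t ht
    by_cases hxL : x ∈ (L : Set X)
    · simp only [hFL' x hxL]
      exact CWComplex.skeletonLT_mono (by exact_mod_cast p.le_succ) hxp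
    · have hkp := hskel p x hx hxp hxL
      obtain ⟨u, hu, rfl⟩ := (hcases x hx).resolve_left hxL
      simp only [hF' u hu]
      exact CWComplex.skeletonLT_mono (by exact_mod_cast (by omega : k + 2 ≤ p + 1))
        (hp.image_subset_skeletonLT (hw ⟨hu, ht⟩))
  · intro p x hx hxp
    by_cases hxL : x ∈ (L : Set X)
    · rwa [hrL hxL]
    · have hkp := hskel p x hx hxp hxL
      obtain ⟨u, hu, rfl⟩ := (hcases x hx).resolve_left hxL
      rw [hr u hu]
      exact CWComplex.skeletonLT_mono (by exact_mod_cast hkp)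
        (hp.mapsTo_baseFace (discRetraction_mem_baseFace hu)).2

lemma IsCellularDeformation.trans {K K' L : CWComplex.Subcomplex C} {r₁ r₂ r : X → X}
    {H₁ H₂ : X × ℝ → X} (h₁ : IsCellularDeformation K K' r₁ H₁)
    (h₂ : IsCellularDeformation K' L r₂ H₂) (hr : EqOn r (r₂ ∘ r₁) K) :
    ∃ H, IsCellularDeformation K L r H := by
  classical
  have hA : ∀ t ∈ Icc (0 : ℝ) 1, t ≤ 1 / 2 → 2 * t ∈ Icc (0 : ℝ) 1 := fun t ht h =>
    ⟨by linarith [ht.1], by linarith⟩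
  have hB : ∀ t ∈ Icc (0 : ℝ) 1, ¬ t ≤ 1 / 2 → 2 * t - 1 ∈ Icc (0 : ℝ) 1 := fun t ht h =>
    ⟨by linarith, by linarith [ht.2]⟩
  refine ⟨fun p => if p.2 ≤ 1 / 2 then H₁ (p.1, 2 * p.2) else H₂ (r₁ p.1, 2 * p.2 - 1),
    h₂.subset.trans h₁.subset, ?_, ?_, ?_, ?_, ?_, ?_, ?_, ?_⟩
  · exact fun x hx => hr hx ▸ h₂.mapsTo_end (h₁.mapsTo_end hx)
  · have hle : closure {p : X × ℝ | p.2 ≤ 1 / 2} ⊆ {p | p.2 ≤ 1 / 2} :=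
      (isClosed_le continuous_snd continuous_const).closure_subset
    have hge : closure {p : X × ℝ | ¬ p.2 ≤ 1 / 2} ⊆ {p | 1 / 2 ≤ p.2} :=
      closure_minimal (fun p (hp : ¬ p.2 ≤ 1 / 2) => (not_le.1 hp).le)
        (isClosed_le continuous_const continuous_snd)
    refine ContinuousOn.if ?_ ?_ ?_
    · rintro ⟨x, t⟩ ⟨⟨hx, ht⟩, hfr⟩
      have h1 : t ≤ 1 / 2 := hle (frontier_subset_closure hfr)
      have h2 : 1 / 2 ≤ t := hge (by rw [frontier_eq_closure_inter_closure] at hfr; exact hfr.2)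
      obtain rfl : t = 1 / 2 := le_antisymm h1 h2
      norm_num
      rw [h₁.map_one x hx, h₂.map_zero _ (h₁.mapsTo_end hx)]
    · refine h₁.continuousOn.comp (by fun_prop) ?_
      rintro ⟨x, t⟩ ⟨⟨hx, ht⟩, h⟩
      exact ⟨hx, hA t ht (hle h)⟩
    · refine h₂.continuousOn.comp
        ((h₁.continuousOn_end.comp continuousOn_fst fun p hp => hp.1.1).prodMk (by fun_prop)) ?_
      rintro ⟨x, t⟩ ⟨⟨hx, ht⟩, h⟩
      have h2 : 1 / 2 ≤ t := hge h
      exact ⟨h₁.mapsTo_end hx, by simp only [mem_Icc]; constructor <;> linarith [ht.2]⟩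
  · rintro ⟨x, t⟩ ⟨hx, ht⟩
    dsimp only
    split_ifs with h
    · exact h₁.mapsTo ⟨hx, hA t ht h⟩
    · exact h₁.subset (h₂.mapsTo ⟨h₁.mapsTo_end hx, hB t ht h⟩)
  · intro x hx
    norm_num
    exact h₁.map_zero x hx
  · intro x hx
    norm_num
    rw [h₂.map_one _ (h₁.mapsTo_end hx), hr hx, Function.comp_apply]
  · intro x hx t ht
    dsimp only
    have hx' := h₂.subset hx
    have hr₁ : r₁ x = x := by
      rw [← h₁.map_one x (h₁.subset hx'), h₁.map_of_mem x hx' 1 (by simp)]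
    split_ifs with h
    · exact h₁.map_of_mem x hx' _ (hA t ht h)
    · rw [hr₁]
      exact h₂.map_of_mem x hx _ (hB t ht h)
  · intro p x hx hxp t ht
    dsimp only
    split_ifs with h
    · exact h₁.map_mem_skeletonLT p x hx hxp _ (hA t ht h)
    · exact h₂.map_mem_skeletonLT p _ (h₁.mapsTo_end hx) (h₁.end_mem_skeletonLT p x hx hxp) _
        (hB t ht h)
  · intro p x hx hxp
    rw [hr hx]
    exact h₂.end_mem_skeletonLT p _ (h₁.mapsTo_end hx) (h₁.end_mem_skeletonLT p x hx hxp)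

/-- The canonical retraction of a collapse is the end of a cellular strong deformation
retraction. -/
theorem CollapsesVia.exists_isCellularDeformation {K L : CWComplex.Subcomplex C}
    {r : X → X} (h : CollapsesVia K L r) : ∃ H, IsCellularDeformation K L r H := by
  induction h with
  | refl K r hr =>
    refine ⟨Prod.fst, Subset.rfl, fun x hx => by rw [hr hx]; exact hx, continuousOn_fst,
      fun p hp => hp.1, fun _ _ => rfl, fun x hx => (hr hx).symm, fun _ _ _ _ => rfl,
      fun p x _ hxp t _ => CWComplex.skeletonLT_mono (by exact_mod_cast p.le_succ) hxp,
      fun p x hx hxp => by rwa [hr hx]⟩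
  | step K K' L r₁ r₂ r h₁ h₂ hr ih =>
    obtain ⟨H₁, hH₁⟩ := h₁.exists_isCellularDeformation
    obtain ⟨H₂, hH₂⟩ := ih
    exact hH₁.trans hH₂ hr

lemma CollapsesVia.subset {K L : CWComplex.Subcomplex C} {r : X → X} (h : CollapsesVia K L r) :
    (L : Set X) ⊆ K :=
  h.exists_isCellularDeformation.choose_spec.subset

lemma CollapsesVia.eqOn {K L : CWComplex.Subcomplex C} {r : X → X} (h : CollapsesVia K L r) :
    EqOn r id L := by
  obtain ⟨H, hH⟩ := h.exists_isCellularDeformation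
  intro x hx
  rw [← hH.map_one x (hH.subset hx), hH.map_of_mem x hx 1 (by simp), id]

/-- An elementary collapse of `K` to `L` extends by the identity to any subcomplex `B` meeting `K`
inside `L`. -/
lemma ElementaryCollapsesVia.union {K L : CWComplex.Subcomplex C} {r : X → X}
    (h : ElementaryCollapsesVia K L r) (B : CWComplex.Subcomplex C) (hB : (K : Set X) ∩ B ⊆ L)
    {r' : X → X} (hr' : EqOn r' r K) (hr'B : EqOn r' id B) :
    ElementaryCollapsesVia (subcomplexUnion K B) (subcomplexUnion L B) r' := by
  obtain ⟨k, a, b, ψ, hp, hK, hrL, hr⟩ := h.exists_isCollapsePair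
  have hK' := hK.trans hp.union_image
  have key : ∀ {n : ℕ} {c : RelCWComplex.cell C n}, c ∉ L.I n → RelCWComplex.openCell n c ⊆ K →
      c ∉ (subcomplexUnion L B).I n := by
    intro n c hc hcK hcu
    obtain ⟨x, hx⟩ := RelCWComplex.openCell_nonempty n c
    rcases openCell_subset_iff.2 hcu hx with hxL | hxB
    · exact hc (mem_I_of_mem_openCell hx hxL)
    · exact hc (mem_I_of_mem_openCell hx (hB ⟨hcK hx, hxB⟩))
  refine ⟨k, a, b, ψ, key hp.notMem_a ?_, key hp.notMem_b ?_, ?_, hp.isCharMap,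
    hp.isCharMap_freeFace, ?_, ?_, ?_⟩
  · exact hK ▸ subset_union_right.trans subset_union_left
  · exact hK ▸ subset_union_right
  · rw [coe_subcomplexUnion, coe_subcomplexUnion, hK]
    rw [union_right_comm, union_right_comm (L : Set X)]
  · exact fun u hu => ⟨Or.inl (hp.mapsTo_baseFace hu).1, (hp.mapsTo_baseFace hu).2⟩
  · rintro x (hx | hx)
    · rw [hr' (hK' ▸ Or.inl hx : x ∈ (K : Set X)), hrL hx]
    · exact hr'B hx
  · intro u hu
    rw [hr' (hK' ▸ Or.inr (mem_image_of_mem ψ hu) : ψ u ∈ (K : Set X)), hr u hu]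

/-- A collapse of `K` to `L` extends by the identity to any subcomplex `B` meeting `K` inside
`L`. -/
lemma CollapsesVia.union {K L : CWComplex.Subcomplex C} {r : X → X}
    (h : CollapsesVia K L r) (B : CWComplex.Subcomplex C) (hB : (K : Set X) ∩ B ⊆ L)
    {r' : X → X} (hr' : EqOn r' r K) (hr'B : EqOn r' id B) :
    CollapsesVia (subcomplexUnion K B) (subcomplexUnion L B) r' := by
  classical
  induction h generalizing r' with
  | refl K r hr =>
    refine .refl _ _ ?_
    rintro x (hx | hx)
    · rw [hr' hx, hr hx]
    · exact hr'B hx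
  | step K K' L r₁ r₂ r h₁ h₂ hr ih =>
    obtain ⟨H₁, hH₁⟩ := h₁.exists_isCellularDeformation
    have hLK' := h₂.subset
    have hr₁ : EqOn r₁ id K' := fun x hx => by
      rw [← hH₁.map_one x (hH₁.subset hx), hH₁.map_of_mem x hx 1 (by simp), id]
    have e₁ : EqOn ((K : Set X).piecewise r₁ id) id B := by
      intro x hx
      by_cases hxK : x ∈ (K : Set X)
      · rw [piecewise_eq_of_mem _ _ _ hxK, hr₁ (hLK' (hB ⟨hxK, hx⟩))]
      · rw [piecewise_eq_of_notMem _ _ _ hxK]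
    have e₂ : EqOn ((K' : Set X).piecewise r₂ id) id B := by
      intro x hx
      by_cases hxK : x ∈ (K' : Set X)
      · rw [piecewise_eq_of_mem _ _ _ hxK, h₂.eqOn (hB ⟨hH₁.subset hxK, hx⟩)]
      · rw [piecewise_eq_of_notMem _ _ _ hxK]
    refine .step _ (subcomplexUnion K' B) _ ((K : Set X).piecewise r₁ id)
      ((K' : Set X).piecewise r₂ id) r'
      (h₁.union B (fun x hx => hLK' (hB hx)) (piecewise_eqOn _ _ _) e₁)
      (ih (fun x hx => hB ⟨hH₁.subset hx.1, hx.2⟩) (piecewise_eqOn _ _ _) e₂) ?_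
    rintro x (hx | hx)
    · rw [hr' hx, hr hx, Function.comp_apply, Function.comp_apply,
        piecewise_eq_of_mem _ _ _ hx, piecewise_eq_of_mem _ _ _ (hH₁.mapsTo_end hx)]
    · rw [hr'B hx, Function.comp_apply, e₁ hx, id, e₂ hx, id]

end Collapse

/-! ### Attaching a cell -/

/-- The underlying set of the space obtained from `X` by attaching an `m`-cell along
`φ : ∂Dᵐ → X`: the disjoint union of `X` and the open disc. Only the values of `φ` on the sphere
matter. -/
def AttachCell {X : Type u} {m : ℕ} (_φ : (Fin m → ℝ) → X) : Type u :=
  X ⊕ ball (0 : Fin m → ℝ) 1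

namespace AttachCell

section Topology

variable {X : Type u} {m : ℕ} (φ : (Fin m → ℝ) → X)

/-- The inclusion of `X`. -/
def base (x : X) : AttachCell φ := Sum.inl x

/-- The inclusion of the open disc. -/
def inner (u : ball (0 : Fin m → ℝ) 1) : AttachCell φ := Sum.inr u

open Classical in
/-- The characteristic map of the attached cell. -/
def disc (u : Fin m → ℝ) : AttachCell φ :=
  if h : u ∈ ball 0 1 then inner φ ⟨u, h⟩ else base φ (φ u)

/-- The coordinates of a point of the attached open cell, with junk value `0` on `X`. -/
def coord : AttachCell φ → Fin m → ℝ := Sum.elim (fun _ => 0) Subtype.val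

variable {φ}

lemma disc_of_mem_ball {u : Fin m → ℝ} (h : u ∈ ball 0 1) : disc φ u = inner φ ⟨u, h⟩ := dif_pos h

lemma disc_of_mem_sphere {u : Fin m → ℝ} (h : u ∈ sphere 0 1) : disc φ u = base φ (φ u) :=
  dif_neg fun h' => (sphere_disjoint_ball.le_bot ⟨h, h'⟩ : False)

lemma base_injective : Function.Injective (base φ) := Sum.inl_injective

lemma inner_injective : Function.Injective (inner φ) := Sum.inr_injective

lemma base_ne_inner (x : X) (u : ball (0 : Fin m → ℝ) 1) : base φ x ≠ inner φ u := Sum.inl_ne_inr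

lemma image_disc_ball : disc φ '' ball 0 1 = range (inner φ) := by
  ext p
  constructor
  · rintro ⟨u, hu, rfl⟩
    exact ⟨⟨u, hu⟩, (disc_of_mem_ball hu).symm⟩
  · rintro ⟨u, rfl⟩
    exact ⟨u, u.2, disc_of_mem_ball u.2⟩

variable [TopologicalSpace X]

/-- The quotient topology of the disjoint union of `X` and the closed disc. -/
instance : TopologicalSpace (AttachCell φ) :=
  TopologicalSpace.coinduced (base φ) inferInstance ⊔
    TopologicalSpace.coinduced (fun u : closedBall (0 : Fin m → ℝ) 1 => disc φ u) inferInstance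

lemma isOpen_iff {s : Set (AttachCell φ)} :
    IsOpen s ↔ IsOpen (base φ ⁻¹' s) ∧
      IsOpen ((fun u : closedBall (0 : Fin m → ℝ) 1 => disc φ u) ⁻¹' s) := Iff.rfl

lemma isClosed_iff {s : Set (AttachCell φ)} :
    IsClosed s ↔ IsClosed (base φ ⁻¹' s) ∧
      IsClosed ((fun u : closedBall (0 : Fin m → ℝ) 1 => disc φ u) ⁻¹' s) := by
  rw [← isOpen_compl_iff, isOpen_iff, preimage_compl, preimage_compl, isOpen_compl_iff,
    isOpen_compl_iff]

lemma continuous_base : Continuous (base φ) :=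
  continuous_def.2 fun _ hs => (isOpen_iff.1 hs).1

lemma continuousOn_disc : ContinuousOn (disc φ) (closedBall 0 1) :=
  continuousOn_iff_continuous_domRestrict.2 <| continuous_def.2 fun _ hs => (isOpen_iff.1 hs).2

lemma continuous_of_comp {Z : Type*} [TopologicalSpace Z] {f : AttachCell φ → Z}
    (h₁ : Continuous (f ∘ base φ)) (h₂ : ContinuousOn (f ∘ disc φ) (closedBall 0 1)) :
    Continuous f :=
  continuous_def.2 fun _ hs => isOpen_iff.2
    ⟨hs.preimage h₁, hs.preimage (continuousOn_iff_continuous_domRestrict.1 h₂)⟩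

/-- A map that separates the points of the open cell from one another and from `X`: it sends `X` to
zero and a point `u` of the disc to `1 - ‖u‖` and `(1 - ‖u‖) u`. -/
def separator : AttachCell φ → ℝ × (Fin m → ℝ) :=
  Sum.elim (fun _ => 0) (fun u => (1 - ‖u.1‖, (1 - ‖u.1‖) • u.1))

lemma continuous_separator : Continuous (separator (φ := φ)) := by
  refine continuous_of_comp continuous_const ?_
  have : Continuous fun u : Fin m → ℝ => ((1 - ‖u‖, (1 - ‖u‖) • u) : ℝ × (Fin m → ℝ)) := by
    fun_prop
  refine this.continuousOn.congr fun u hu => ?_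
  dsimp only [Function.comp_apply]
  rcases (mem_closedBall_zero_iff.1 hu).lt_or_eq with h | h
  · rw [disc_of_mem_ball (mem_ball_zero_iff.2 h)]
    rfl
  · rw [disc_of_mem_sphere (mem_sphere_zero_iff_norm.2 h), h, sub_self, zero_smul]
    rfl

/-- The union of `U ⊆ X` with its radial collar in the attached cell. -/
def collar (U : Set X) : Set (AttachCell φ) :=
  {p | Sum.elim (· ∈ U) (fun u => 1 / 2 < ‖u.1‖ ∧ φ (‖u.1‖⁻¹ • u.1) ∈ U) p}

lemma isOpen_collar (hφ : ContinuousOn φ (sphere 0 1)) {U : Set X} (hU : IsOpen U) :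
    IsOpen (collar (φ := φ) U) := by
  refine isOpen_iff.2 ⟨hU, ?_⟩
  have hopen : IsOpen {u : Fin m → ℝ | 1 / 2 < ‖u‖} := isOpen_lt continuous_const continuous_norm
  have hc : ContinuousOn (fun u : Fin m → ℝ => φ (‖u‖⁻¹ • u)) {u | 1 / 2 < ‖u‖} := by
    have hne : ∀ u ∈ {u : Fin m → ℝ | 1 / 2 < ‖u‖}, ‖u‖ ≠ 0 := fun u (hu : 1 / 2 < ‖u‖) => by
      positivity
    refine hφ.comp ((continuous_norm.continuousOn.inv₀ hne).smul continuousOn_id) fun u hu => ?_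
    rw [mem_sphere_zero_iff_norm, norm_smul, norm_inv, norm_norm, inv_mul_cancel₀ (hne u hu)]
  convert (hc.isOpen_inter_preimage hopen hU).preimage
    (continuous_subtype_val (p := fun u => u ∈ closedBall (0 : Fin m → ℝ) 1)) using 1
  ext ⟨u, hu⟩
  rcases (mem_closedBall_zero_iff.1 hu).lt_or_eq with h | h
  · simp only [mem_preimage, disc_of_mem_ball (mem_ball_zero_iff.2 h)]
    rfl
  · simp only [mem_preimage, disc_of_mem_sphere (mem_sphere_zero_iff_norm.2 h), mem_inter_iff,
      mem_ofPred_eq, h, inv_one, one_smul]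
    exact ⟨fun h' => ⟨by norm_num, h'⟩, fun h' => h'.2⟩

lemma t2Space [T2Space X] (hφ : ContinuousOn φ (sphere 0 1)) : T2Space (AttachCell φ) := by
  refine ⟨fun p q hpq => ?_⟩
  by_cases hsep : separator p = separator q
  · have hpos : ∀ u : ball (0 : Fin m → ℝ) 1, 1 - ‖u.1‖ ≠ 0 := fun u =>
      (sub_pos.2 (mem_ball_zero_iff.1 u.2)).ne'
    rcases p with x | u <;> rcases q with y | v
    · obtain ⟨U, V, hU, hV, hx, hy, hUV⟩ := t2_separation fun h : x = y => hpq (h ▸ rfl)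
      refine ⟨collar U, collar V, isOpen_collar hφ hU, isOpen_collar hφ hV, hx, hy,
        disjoint_left.2 ?_⟩
      rintro (z | w) hzU hzV
      · exact hUV.notMem_of_mem_left hzU hzV
      · exact hUV.notMem_of_mem_left hzU.2 hzV.2
    · exact (hpos v (congrArg Prod.fst hsep).symm).elim
    · exact (hpos u (congrArg Prod.fst hsep)).elim
    · have h1 : 1 - ‖u.1‖ = 1 - ‖v.1‖ := congrArg Prod.fst hsep
      have h2 : (1 - ‖u.1‖) • u.1 = (1 - ‖v.1‖) • v.1 := congrArg Prod.snd hsep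
      rw [h1] at h2
      exact (hpq (congrArg Sum.inr (Subtype.ext (smul_right_injective _ (hpos v) h2)))).elim
  · exact separated_by_continuous continuous_separator hsep

lemma isClosedEmbedding_base (hφ : ContinuousOn φ (sphere 0 1)) : IsClosedEmbedding (base φ) := by
  refine .of_continuous_injective_isClosedMap continuous_base base_injective fun A hA => ?_
  refine isClosed_iff.2 ⟨?_, ?_⟩
  · rwa [preimage_image_eq _ base_injective]
  · convert (hφ.preimage_isClosed_of_isClosed isClosed_sphere hA).preimage
      (continuous_subtype_val (p := fun u => u ∈ closedBall (0 : Fin m → ℝ) 1)) using 1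
    ext ⟨u, hu⟩
    rcases (mem_closedBall_zero_iff.1 hu).lt_or_eq with h | h
    · simp only [mem_preimage, disc_of_mem_ball (mem_ball_zero_iff.2 h), mem_inter_iff]
      refine ⟨fun ⟨x, _, hx⟩ => (base_ne_inner _ _ hx).elim, fun h' => ?_⟩
      exact (h.ne (mem_sphere_zero_iff_norm.1 h'.1)).elim
    · have h' := mem_sphere_zero_iff_norm.2 h
      simp only [mem_preimage, disc_of_mem_sphere h', mem_inter_iff, h', true_and,
        base_injective.mem_set_image]

lemma continuousOn_coord : ContinuousOn (coord φ) (range (inner φ)) := by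
  have hopen : ∀ V : Set (Fin m → ℝ), IsOpen V → IsOpen (inner φ '' (Subtype.val ⁻¹' V)) := by
    intro V hV
    refine isOpen_iff.2 ⟨?_, ?_⟩
    · convert isOpen_empty
      exact eq_empty_of_forall_notMem fun x ⟨u, _, hu⟩ => base_ne_inner _ _ hu.symm
    · convert (hV.inter (isOpen_ball (x := (0 : Fin m → ℝ)) (ε := 1))).preimage
        (continuous_subtype_val (p := fun u => u ∈ closedBall (0 : Fin m → ℝ) 1)) using 1
      ext ⟨u, hu⟩
      by_cases h : u ∈ ball (0 : Fin m → ℝ) 1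
      · simp only [mem_preimage, disc_of_mem_ball h, mem_inter_iff, h, and_true,
          inner_injective.mem_set_image]
      · have h' : disc φ u = base φ (φ u) := dif_neg h
        simp only [mem_preimage, h', mem_inter_iff, h, and_false, iff_false]
        exact fun ⟨v, _, hv⟩ => base_ne_inner _ _ hv.symm
  have hr : IsOpen (range (inner φ)) := by
    have := hopen univ isOpen_univ
    rwa [preimage_univ, image_univ] at this
  refine (continuousOn_open_iff hr).2 fun V hV => ?_
  convert hopen V hV
  ext p
  constructor
  · rintro ⟨⟨u, rfl⟩, hu⟩
    exact ⟨u, hu, rfl⟩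
  · rintro ⟨u, hu, rfl⟩
    exact ⟨⟨u, rfl⟩, hu⟩

end Topology

section Structure

variable {X : Type u} {m : ℕ} (φ : (Fin m → ℝ) → X)

/-- The characteristic map of the attached cell as a partial equivalence. Its dimension is a
variable `n` with `n = m` as the type of cells has to be a family over all dimensions. -/
def discEquiv (n : ℕ) (h : n = m) : PartialEquiv (Fin n → ℝ) (AttachCell φ) where
  toFun u := disc φ (fun i => u (Fin.cast h.symm i))
  invFun p i := coord φ p (Fin.cast h i)
  source := ball 0 1
  target := range (inner φ)
  map_source' := by
    subst h
    intro u hu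
    exact ⟨⟨u, hu⟩, (disc_of_mem_ball hu).symm⟩
  map_target' := by
    subst h
    rintro _ ⟨u, rfl⟩
    exact u.2
  left_inv' := by
    subst h
    intro u hu
    change coord φ (disc φ u) = u
    rw [disc_of_mem_ball hu]
    rfl
  right_inv' := by
    subst h
    rintro _ ⟨u, rfl⟩
    exact disc_of_mem_ball u.2

lemma image_discEquiv (n : ℕ) (h : n = m) : discEquiv φ n h '' ball 0 1 = range (inner φ) := by
  subst h
  exact image_disc_ball

variable [TopologicalSpace X] [CWComplex (univ : Set X)]

/-- The characteristic map of a cell of `X` as a map to the larger complex. -/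
def oldMap (n : ℕ) (c : RelCWComplex.cell (univ : Set X) n) :
    PartialEquiv (Fin n → ℝ) (AttachCell φ) where
  toFun u := base φ (RelCWComplex.map n c u)
  invFun := Sum.elim (RelCWComplex.map n c).symm (fun _ => 0)
  source := ball 0 1
  target := base φ '' (RelCWComplex.map n c).target
  map_source' u hu := mem_image_of_mem _
    ((RelCWComplex.map n c).map_source (by rwa [RelCWComplex.source_eq]))
  map_target' := by
    rintro _ ⟨x, hx, rfl⟩
    rw [← RelCWComplex.source_eq n c]
    exact (RelCWComplex.map n c).map_target hx
  left_inv' u hu := (RelCWComplex.map n c).left_inv (by rwa [RelCWComplex.source_eq])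
  right_inv' := by
    rintro _ ⟨x, hx, rfl⟩
    exact congrArg (base φ) ((RelCWComplex.map n c).right_inv hx)

/-- The characteristic maps of the larger complex. -/
def cellMap (n : ℕ) : RelCWComplex.cell (univ : Set X) n ⊕ ULift.{u} (PLift (n = m)) →
    PartialEquiv (Fin n → ℝ) (AttachCell φ) :=
  Sum.elim (oldMap φ n) (fun h => discEquiv φ n h.down.down)

lemma image_oldMap (n : ℕ) (c : RelCWComplex.cell (univ : Set X) n) (s : Set (Fin n → ℝ)) :
    oldMap φ n c '' s = base φ '' (RelCWComplex.map n c '' s) :=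
  image_comp (base φ) (RelCWComplex.map n c) s

variable {φ}

lemma pairwiseDisjoint_cellMap :
    (univ : Set (Σ n, RelCWComplex.cell (univ : Set X) n ⊕ ULift.{u} (PLift (n = m)))).PairwiseDisjoint
      (fun c => cellMap φ c.1 c.2 '' ball 0 1) := by
  have hdisj : ∀ s : Set X, Disjoint (base φ '' s) (range (inner φ)) := fun s =>
    disjoint_left.2 fun _ ⟨_, _, hx⟩ ⟨_, hu⟩ => base_ne_inner _ _ (hx.trans hu.symm)
  rintro ⟨n, c | h⟩ - ⟨n', c' | h'⟩ - hne
  · have hne' : (⟨n, c⟩ : Σ n, RelCWComplex.cell (univ : Set X) n) ≠ ⟨n', c'⟩ := by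
      intro he
      cases he
      exact hne rfl
    change Disjoint (oldMap φ n c '' ball 0 1) (oldMap φ n' c' '' ball 0 1)
    rw [image_oldMap, image_oldMap, disjoint_image_iff base_injective]
    exact CWComplex.disjoint_openCell_of_ne hne'
  · change Disjoint (oldMap φ n c '' ball 0 1) (discEquiv φ n' _ '' ball 0 1)
    rw [image_oldMap, image_discEquiv]
    exact hdisj _
  · change Disjoint (discEquiv φ n _ '' ball 0 1) (oldMap φ n' c' '' ball 0 1)
    rw [image_oldMap, image_discEquiv]
    exact (hdisj _).symm
  · obtain ⟨⟨rfl⟩⟩ := h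
    obtain ⟨⟨rfl⟩⟩ := h'
    exact (hne rfl).elim

variable [T2Space X]

lemma base_mem_iUnion {n : ℕ} {x : X} (hx : x ∈ CWComplex.skeletonLT (univ : Set X) n) :
    base φ x ∈ ⋃ (k < n) (c), cellMap φ k c '' closedBall 0 1 := by
  obtain ⟨k, hk, c, hc⟩ := CWComplex.mem_skeletonLT_iff.1 hx
  refine mem_iUnion₂.2 ⟨k, by exact_mod_cast hk, mem_iUnion.2 ⟨Sum.inl c, ?_⟩⟩
  change base φ x ∈ oldMap φ k c '' closedBall 0 1
  rw [image_oldMap]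
  exact mem_image_of_mem _ (CWComplex.openCell_subset_closedCell k c hc)

end Structure

section Finite

variable {X : Type u} [TopologicalSpace X] [CWComplex (univ : Set X)]
  [hX : CWComplex.Finite (univ : Set X)]

lemma eventually_isEmpty_cell (m : ℕ) : ∀ᶠ n in Filter.atTop,
    IsEmpty (RelCWComplex.cell (univ : Set X) n ⊕ ULift.{u} (PLift (n = m))) := by
  filter_upwards [hX.eventually_isEmpty_cell, Filter.eventually_gt_atTop m] with n hn hmn
  exact isEmpty_sum.2 ⟨hn, ⟨fun h => hmn.ne' h.down.down⟩⟩

lemma finite_cell (m n : ℕ) :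
    _root_.Finite (RelCWComplex.cell (univ : Set X) n ⊕ ULift.{u} (PLift (n = m))) := by
  have := hX.finite_cell n
  infer_instance

end Finite


end AttachCell

/-- A cell can be attached to a finite CW complex along any continuous map of its boundary to the
skeleton of smaller dimension. -/
theorem exists_attachCell {X : Type u} [TopologicalSpace X] [T2Space X] [CWComplex (univ : Set X)]
    [CWComplex.Finite (univ : Set X)] {m : ℕ} (φ : (Fin m → ℝ) → X)
    (hφ : ContinuousOn φ (sphere 0 1))
    (hφs : MapsTo φ (sphere 0 1) (CWComplex.skeletonLT (univ : Set X) m : Set X)) :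
    ∃ (Y : Type u) (_ : TopologicalSpace Y) (_ : T2Space Y) (_ : CWComplex (univ : Set Y))
      (_ : CWComplex.Finite (univ : Set Y)) (ι : CellularInclusion X Y)
      (c : RelCWComplex.cell (univ : Set Y) m),
      (∀ u ∈ sphere (0 : Fin m → ℝ) 1, RelCWComplex.map m c u = ι.toFun (φ u)) ∧
      Disjoint (range ι.toFun) (RelCWComplex.openCell m c) := by
  have hold : ∀ (n : ℕ) (c : RelCWComplex.cell (univ : Set X) n),
      ContinuousOn (AttachCell.oldMap φ n c).symm (AttachCell.oldMap φ n c).target := by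
    intro n c
    have hi := (AttachCell.isClosedEmbedding_base hφ).isInducing
    change ContinuousOn _ (AttachCell.base φ '' (RelCWComplex.map n c).target)
    rw [hi.continuousOn_image_iff]
    exact RelCWComplex.continuousOn_symm n c
  have hT2 := AttachCell.t2Space hφ
  let S : CWComplex (univ : Set (AttachCell φ)) := CWComplex.mkFinite univ
    (fun n => RelCWComplex.cell (univ : Set X) n ⊕ ULift.{u} (PLift (n = m)))
    (AttachCell.cellMap φ) (AttachCell.eventually_isEmpty_cell m)
    (AttachCell.finite_cell m)
    (by rintro n (c | h) <;> rfl)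
    (by
      rintro n (c | ⟨⟨⟨rfl⟩⟩⟩)
      · exact AttachCell.continuous_base.comp_continuousOn (RelCWComplex.continuousOn n c)
      · exact AttachCell.continuousOn_disc)
    (by
      rintro n (c | ⟨⟨⟨rfl⟩⟩⟩)
      · exact hold n c
      · exact AttachCell.continuousOn_coord)
    AttachCell.pairwiseDisjoint_cellMap
    (by
      rintro n (c | ⟨⟨⟨rfl⟩⟩⟩) u hu
      · exact AttachCell.base_mem_iUnion
          (CWComplex.cellFrontier_subset_skeletonLT n c (mem_image_of_mem _ hu))
      · change AttachCell.disc φ u ∈ _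
        rw [AttachCell.disc_of_mem_sphere hu]
        exact AttachCell.base_mem_iUnion (hφs hu))
    (by
      refine eq_univ_of_forall fun p => ?_
      rcases p with x | u
      · have hx := mem_univ x
        rw [← CWComplex.union (C := (univ : Set X))] at hx
        obtain ⟨n, c, hc⟩ := mem_iUnion₂.1 hx
        refine mem_iUnion₂.2 ⟨n, Sum.inl c, ?_⟩
        change AttachCell.base φ x ∈ AttachCell.oldMap φ n c '' _
        rw [AttachCell.image_oldMap]
        exact mem_image_of_mem _ hc
      · exact mem_iUnion₂.2 ⟨m, Sum.inr ⟨⟨rfl⟩⟩, u.1, ball_subset_closedBall u.2,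
          AttachCell.disc_of_mem_ball u.2⟩)
  refine ⟨AttachCell φ, inferInstance, hT2, S, CWComplex.finite_mkFinite _ _ _ _ _ _ _ _ _ _ _,
    ⟨AttachCell.base φ, fun n => Sum.inl, AttachCell.isClosedEmbedding_base hφ,
      fun n c x hx => rfl⟩, Sum.inr ⟨⟨rfl⟩⟩, fun u hu => AttachCell.disc_of_mem_sphere hu, ?_⟩
  change Disjoint _ (AttachCell.discEquiv φ m _ '' ball 0 1)
  rw [AttachCell.image_discEquiv]
  exact disjoint_left.2 fun _ ⟨_, hx⟩ ⟨_, hu⟩ => AttachCell.base_ne_inner _ _ (hx.trans hu.symm)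

/-! ### Prisms over a cell -/

/-- Maps on the top and on the bottom of the cube `D^{m+1}` and a homotopy on its vertical sides
fit together to a map on its boundary. -/
lemma exists_prism_boundary {X : Type u} [TopologicalSpace X] {m : ℕ} {f g : (Fin m → ℝ) → X}
    {G : (Fin m → ℝ) × ℝ → X} (hf : ContinuousOn f (closedBall 0 1))
    (hg : ContinuousOn g (closedBall 0 1)) (hG : ContinuousOn G (sphere 0 1 ×ˢ Icc 0 1))
    (hGf : ∀ y ∈ sphere (0 : Fin m → ℝ) 1, G (y, 0) = f y)
    (hGg : ∀ y ∈ sphere (0 : Fin m → ℝ) 1, G (y, 1) = g y) :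
    ∃ φ : (Fin (m + 1) → ℝ) → X, ContinuousOn φ (sphere 0 1) ∧
      (∀ x, x (Fin.last m) = 1 → φ x = f (horiz x)) ∧
      (∀ x, x (Fin.last m) = -1 → φ x = g (horiz x)) ∧
      ∀ x ∈ sphere 0 1, ‖horiz x‖ = 1 → φ x = G (horiz x, (1 - x (Fin.last m)) / 2) := by
  classical
  let φ : (Fin (m + 1) → ℝ) → X := fun x =>
    if x (Fin.last m) = 1 then f (horiz x) else
    if x (Fin.last m) = -1 then g (horiz x) else G (horiz x, (1 - x (Fin.last m)) / 2)
  have h1 : ∀ x, x (Fin.last m) = 1 → φ x = f (horiz x) := fun x hx => if_pos hx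
  have h2 : ∀ x, x (Fin.last m) = -1 → φ x = g (horiz x) := fun x hx => by
    have hx' : ¬ x (Fin.last m) = 1 := by rw [hx]; norm_num
    simp only [φ, if_neg hx', if_pos hx]
  have h3 : ∀ x ∈ sphere 0 1, ‖horiz x‖ = 1 → φ x = G (horiz x, (1 - x (Fin.last m)) / 2) := by
    intro x _ hx
    by_cases ht : x (Fin.last m) = 1
    · rw [h1 x ht, ht, ← hGf _ (mem_sphere_zero_iff_norm.2 hx)]
      norm_num
    by_cases ht' : x (Fin.last m) = -1
    · rw [h2 x ht', ht', ← hGg _ (mem_sphere_zero_iff_norm.2 hx)]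
      norm_num
    · simp only [φ, if_neg ht, if_neg ht']
  refine ⟨φ, ?_, h1, h2, h3⟩
  have hlast : Continuous fun x : Fin (m + 1) → ℝ => x (Fin.last m) := continuous_apply _
  have hs : (sphere 0 1 : Set (Fin (m + 1) → ℝ)) =
      ((sphere 0 1 ∩ {x | x (Fin.last m) = 1}) ∪ (sphere 0 1 ∩ {x | x (Fin.last m) = -1})) ∪
        (sphere 0 1 ∩ {x | ‖horiz x‖ = 1}) := by
    rw [← inter_union_distrib_left, ← inter_union_distrib_left, eq_comm, inter_eq_left]
    intro x hx
    rw [mem_sphere_zero_iff_norm, norm_eq_max] at hx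
    rcases max_choice ‖horiz x‖ |x (Fin.last m)| with h | h <;> rw [h] at hx
    · exact Or.inr hx
    · exact Or.inl (eq_or_eq_neg_of_abs_eq hx)
  have hmem : ∀ x ∈ (sphere 0 1 : Set (Fin (m + 1) → ℝ)), horiz x ∈ closedBall (0 : Fin m → ℝ) 1 :=
    fun x hx => mem_closedBall_zero_iff.2 (mem_closedBall_iff_horiz.1 (sphere_subset_closedBall hx)).1
  rw [hs]
  refine ContinuousOn.union_of_isClosed (ContinuousOn.union_of_isClosed ?_ ?_ ?_ ?_) ?_
    (IsClosed.union ?_ ?_) ?_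
  · exact (hf.comp continuous_horiz.continuousOn fun x hx => hmem x hx.1).congr
      fun x hx => h1 x hx.2
  · exact (hg.comp continuous_horiz.continuousOn fun x hx => hmem x hx.1).congr
      fun x hx => h2 x hx.2
  · exact isClosed_sphere.inter (isClosed_eq hlast continuous_const)
  · exact isClosed_sphere.inter (isClosed_eq hlast continuous_const)
  · refine (hG.comp (f := fun x : Fin (m + 1) → ℝ => (horiz x, (1 - x (Fin.last m)) / 2))
      (continuous_horiz.prodMk (by fun_prop)).continuousOn fun x hx => ?_).congr
      fun x hx => h3 x hx.1 hx.2
    have ht := abs_le.1 (mem_closedBall_iff_horiz.1 (sphere_subset_closedBall hx.1)).2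
    exact ⟨mem_sphere_zero_iff_norm.2 hx.2, by constructor <;> linarith⟩
  · exact isClosed_sphere.inter (isClosed_eq hlast continuous_const)
  · exact isClosed_sphere.inter (isClosed_eq hlast continuous_const)
  · exact isClosed_sphere.inter (isClosed_eq continuous_horiz.norm continuous_const)

/-- Let `r` be the end of a cellular deformation `H` of `Z`, and `e` a cell with boundary in `Z`.
One can attach a cell `e'` along `r ∘ φ`, where `φ` is the attaching map of `e`, and then a prism
`E` with top `e` and bottom `e'`, whose vertical sides follow `H`. -/
theorem exists_prism {X : Type u} [TopologicalSpace X] [T2Space X] [CWComplex (univ : Set X)]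
    [CWComplex.Finite (univ : Set X)] {m : ℕ} {e : RelCWComplex.cell (univ : Set X) m}
    {Z M : CWComplex.Subcomplex (univ : Set X)} {r : X → X} {H : X × ℝ → X}
    (hH : IsCellularDeformation Z M r H) (he : RelCWComplex.cellFrontier m e ⊆ Z) :
    ∃ (Y : Type u) (_ : TopologicalSpace Y) (_ : T2Space Y) (_ : CWComplex (univ : Set Y))
      (_ : CWComplex.Finite (univ : Set Y)) (ι : CellularInclusion X Y)
      (e' : RelCWComplex.cell (univ : Set Y) m) (E : RelCWComplex.cell (univ : Set Y) (m + 1)),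
      Disjoint (range ι.toFun) (RelCWComplex.openCell m e') ∧
      Disjoint (range ι.toFun) (RelCWComplex.openCell (m + 1) E) ∧
      (∀ y ∈ sphere (0 : Fin m → ℝ) 1,
        RelCWComplex.map m e' y = ι.toFun (r (RelCWComplex.map m e y))) ∧
      (∀ x ∈ closedBall (0 : Fin (m + 1) → ℝ) 1, x (Fin.last m) = 1 →
        RelCWComplex.map (m + 1) E x = RelCWComplex.map m (ι.cellMap m e) (horiz x)) ∧
      (∀ x ∈ closedBall (0 : Fin (m + 1) → ℝ) 1, x (Fin.last m) = -1 →
        RelCWComplex.map (m + 1) E x = RelCWComplex.map m e' (horiz x)) ∧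
      ∀ x ∈ closedBall (0 : Fin (m + 1) → ℝ) 1, ‖horiz x‖ = 1 →
        RelCWComplex.map (m + 1) E x ∈
          ι.toFun '' Z ∩ (CWComplex.skeleton (univ : Set Y) m : Set Y) := by
  have heZ : ∀ y ∈ sphere (0 : Fin m → ℝ) 1, RelCWComplex.map m e y ∈ (Z : Set X) :=
    fun y hy => he (mem_image_of_mem _ hy)
  have hes : ∀ y ∈ sphere (0 : Fin m → ℝ) 1,
      RelCWComplex.map m e y ∈ CWComplex.skeletonLT (univ : Set X) m :=
    fun y hy => (isCharMap_map m e).mapsTo hy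
  have hec : ContinuousOn (RelCWComplex.map m e) (sphere 0 1) :=
    (RelCWComplex.continuousOn m e).mono sphere_subset_closedBall
  obtain ⟨X₁, _, _, _, _, ι₁, e₁, he₁, hd₁⟩ := exists_attachCell
    (fun y => r (RelCWComplex.map m e y)) (hH.continuousOn_end.comp hec heZ)
    fun y hy => hH.end_mem_skeletonLT m _ (heZ y hy) (hes y hy)
  have hcell₁ : ∀ y ∈ closedBall (0 : Fin m → ℝ) 1, ∀ c : RelCWComplex.cell (univ : Set X₁) m,
      RelCWComplex.map m c y ∈ CWComplex.skeletonLT (univ : Set X₁) ((m + 1 : ℕ) : ℕ∞) :=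
    fun y hy c => by
      have := CWComplex.closedCell_subset_skeletonLT m c (mem_image_of_mem _ hy)
      exact_mod_cast this
  have hside : ∀ y ∈ sphere (0 : Fin m → ℝ) 1, ∀ t ∈ Icc (0 : ℝ) 1,
      H (RelCWComplex.map m e y, t) ∈ CWComplex.skeletonLT (univ : Set X) ((m + 1 : ℕ) : ℕ∞) :=
    fun y hy t ht => hH.map_mem_skeletonLT m _ (heZ y hy) (hes y hy) t ht
  obtain ⟨φ, hφ, hφtop, hφbot, hφside⟩ := exists_prism_boundary
    (f := RelCWComplex.map m (ι₁.cellMap m e)) (g := RelCWComplex.map m e₁)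
    (G := fun p => ι₁.toFun (H (RelCWComplex.map m e p.1, p.2)))
    (RelCWComplex.continuousOn m _) (RelCWComplex.continuousOn m _)
    (ι₁.isClosedEmbedding.continuous.comp_continuousOn
      (hH.continuousOn.comp (f := fun p : (Fin m → ℝ) × ℝ => (RelCWComplex.map m e p.1, p.2))
        ((hec.comp continuousOn_fst fun p hp => hp.1).prodMk continuousOn_snd)
        fun p hp => ⟨heZ p.1 hp.1, hp.2⟩))
    (fun y hy => by rw [hH.map_zero _ (heZ y hy), ι₁.map_eq m e y (sphere_subset_closedBall hy)])
    (fun y hy => by rw [hH.map_one _ (heZ y hy), he₁ y hy])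
  have htime : ∀ x ∈ closedBall (0 : Fin (m + 1) → ℝ) 1,
      (1 - x (Fin.last m)) / 2 ∈ Icc (0 : ℝ) 1 := fun x hx => by
    have ht := abs_le.1 (mem_closedBall_iff_horiz.1 hx).2
    constructor <;> linarith
  have hhoriz : ∀ x ∈ closedBall (0 : Fin (m + 1) → ℝ) 1, horiz x ∈ closedBall (0 : Fin m → ℝ) 1 :=
    fun x hx => mem_closedBall_zero_iff.2 (mem_closedBall_iff_horiz.1 hx).1
  have hφs : MapsTo φ (sphere 0 1) (CWComplex.skeletonLT (univ : Set X₁) ((m + 1 : ℕ) : ℕ∞)) := by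
    intro x hx
    have hx' := sphere_subset_closedBall hx
    have hn := hx
    rw [mem_sphere_zero_iff_norm, norm_eq_max] at hn
    rcases max_choice ‖horiz x‖ |x (Fin.last m)| with h | h
    · have h1 : ‖horiz x‖ = 1 := h ▸ hn
      rw [hφside x hx h1]
      exact ι₁.map_mem_skeletonLT
        (hside _ (mem_sphere_zero_iff_norm.2 h1) _ (htime x hx'))
    · rcases eq_or_eq_neg_of_abs_eq (h ▸ hn) with h1 | h1
      · rw [hφtop x h1]
        exact hcell₁ _ (hhoriz x hx') _
      · rw [hφbot x h1]
        exact hcell₁ _ (hhoriz x hx') _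
  obtain ⟨Y, _, _, _, _, ι₂, E, hE, hdE⟩ := exists_attachCell φ hφ hφs
  have hsph : ∀ x ∈ closedBall (0 : Fin (m + 1) → ℝ) 1,
      (|x (Fin.last m)| = 1 ∨ ‖horiz x‖ = 1) → x ∈ sphere (0 : Fin (m + 1) → ℝ) 1 := by
    intro x hx h
    have hx' := mem_closedBall_iff_horiz.1 hx
    rw [mem_sphere_zero_iff_norm, norm_eq_max]
    rcases h with h | h
    · rw [h, max_eq_right hx'.1]
    · rw [h, max_eq_left hx'.2]
  refine ⟨Y, _, ‹_›, _, ‹_›, ι₂.comp ι₁, ι₂.cellMap m e₁, E, ?_, ?_, ?_, ?_, ?_, ?_⟩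
  · change Disjoint (range (ι₂.toFun ∘ ι₁.toFun)) _
    rw [range_comp, ι₂.openCell_cellMap, disjoint_image_iff ι₂.injective]
    exact hd₁
  · exact hdE.mono_left (range_comp_subset_range ι₁.toFun ι₂.toFun)
  · intro y hy
    rw [← ι₂.map_eq m e₁ y (sphere_subset_closedBall hy), he₁ y hy]
    rfl
  · intro x hx h
    rw [hE x (hsph x hx (Or.inl (by rw [h, abs_one]))), hφtop x h]
    exact ι₂.map_eq m _ _ (hhoriz x hx)
  · intro x hx h
    rw [hE x (hsph x hx (Or.inl (by rw [h, abs_neg, abs_one]))), hφbot x h]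
    exact ι₂.map_eq m _ _ (hhoriz x hx)
  · intro x hx h
    have hxs := hsph x hx (Or.inr h)
    have hy : horiz x ∈ sphere (0 : Fin m → ℝ) 1 := mem_sphere_zero_iff_norm.2 h
    rw [hE x hxs, hφside x hxs h]
    refine ⟨mem_image_of_mem _ (hH.mapsTo ⟨heZ _ hy, htime x hx⟩), ?_⟩
    have := (ι₂.comp ι₁).map_mem_skeletonLT (hside _ hy _ (htime x hx))
    exact_mod_cast this

/-- The effect on a single cell `e`: if `Z` collapses to both `A` and `M`, then adding `e` and a
prism over it to `Z` gives a complex that collapses to both `A ∪ e` and `M ∪ e'`. -/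
theorem exists_collapses_of_isCellAttachment {X : Type u} [TopologicalSpace X] [T2Space X]
    [CWComplex (univ : Set X)] [CWComplex.Finite (univ : Set X)] {m : ℕ}
    {e : RelCWComplex.cell (univ : Set X) m} {A B Z M : CWComplex.Subcomplex (univ : Set X)}
    {r : X → X} (hAB : IsCellAttachment A B m e) (heZ : e ∉ Z.I m) (hZA : Collapses Z A)
    (hZM : CollapsesVia Z M r) :
    ∃ (Y : Type u) (_ : TopologicalSpace Y) (_ : T2Space Y) (_ : CWComplex (univ : Set Y))
      (_ : CWComplex.Finite (univ : Set Y)) (ι : CellularInclusion X Y)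
      (Z' M' : CWComplex.Subcomplex (univ : Set Y)) (e' : RelCWComplex.cell (univ : Set Y) m)
      (r' : Y → Y),
      ι.image Z ≤ Z' ∧ (∀ n, DimLE Z n → m + 1 ≤ n → DimLE Z' n) ∧
      ι.toFun ⁻¹' Z' ⊆ Z ∪ B ∧ Collapses Z' (ι.image B) ∧ CollapsesVia Z' M' r' ∧
      IsCellAttachment (ι.image M) M' m e' ∧
      ∀ y ∈ sphere (0 : Fin m → ℝ) 1,
        RelCWComplex.map m e' y = ι.toFun (r (RelCWComplex.map m e y)) := by
  classical
  obtain ⟨rA, hrA⟩ := hZA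
  obtain ⟨H, hH⟩ := hZM.exists_isCellularDeformation
  have hfr : RelCWComplex.cellFrontier m e ⊆ (Z : Set X) :=
    hAB.cellFrontier_subset.trans hrA.subset
  obtain ⟨Y, _, _, _, _, ι, e', E, hde', hdE, he', htop, hbot, hside⟩ := exists_prism hH hfr
  have hfr' : RelCWComplex.cellFrontier m e' ⊆ (ι.image M : Set Y) := by
    rintro _ ⟨y, hy, rfl⟩
    rw [he' y hy]
    exact mem_image_of_mem _ (hH.mapsTo_end (hfr (mem_image_of_mem _ hy)))
  have hZM' : (ι.image M : Set Y) ⊆ ι.image Z := ι.image_mono hH.subset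
  have hdee' : Disjoint (RelCWComplex.openCell m (ι.cellMap m e)) (RelCWComplex.openCell m e') :=
    hde'.mono_left (by rw [ι.openCell_cellMap]; exact image_subset_range _ _)
  have hdeZ : Disjoint (RelCWComplex.openCell m (ι.cellMap m e)) (ι.image Z : Set Y) :=
    CWComplex.Subcomplex.disjoint_openCell_subcomplex_of_not_mem _
      fun h => heZ (ι.cellMap_mem_image_iff.1 h)
  have hde'Z : Disjoint (ι.image Z : Set Y) (RelCWComplex.openCell m e') :=
    hde'.mono_left (image_subset_range _ _)
  have hdEZ : Disjoint (ι.image Z : Set Y) (RelCWComplex.openCell (m + 1) E) :=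
    hdE.mono_left (image_subset_range _ _)
  -- `Z ∪ e`, `Z ∪ e'`, and `Z ∪ e ∪ e' ∪ E`
  let Ze := insertCell (ι.image Z) m (ι.cellMap m e) (by
    rw [ι.cellFrontier_cellMap]; exact Set.image_mono hfr)
  let Ze' := insertCell (ι.image Z) m e' (hfr'.trans hZM')
  let Zee' := insertCell Ze m e' ((hfr'.trans hZM').trans subset_union_left)
  have hZe : (Ze : Set Y) = (ι.image Z : Set Y) ∪ RelCWComplex.openCell m (ι.cellMap m e) := rfl
  have hZe' : (Ze' : Set Y) = (ι.image Z : Set Y) ∪ RelCWComplex.openCell m e' := rfl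
  have hZee' : (Zee' : Set Y) = (Ze : Set Y) ∪ RelCWComplex.openCell m e' := rfl
  have hclosed_e : RelCWComplex.closedCell m (ι.cellMap m e) ⊆ (Ze : Set Y) :=
    CWComplex.Subcomplex.closedCell_subset_of_mem Ze
      (openCell_subset_iff.1 (hZe ▸ subset_union_right))
  have hclosed_e' : RelCWComplex.closedCell m e' ⊆ (Ze' : Set Y) :=
    CWComplex.Subcomplex.closedCell_subset_of_mem Ze'
      (openCell_subset_iff.1 (hZe' ▸ subset_union_right))
  have hhoriz : ∀ x ∈ closedBall (0 : Fin (m + 1) → ℝ) 1, horiz x ∈ closedBall (0 : Fin m → ℝ) 1 :=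
    fun x hx => mem_closedBall_zero_iff.2 (mem_closedBall_iff_horiz.1 hx).1
  have hE : RelCWComplex.cellFrontier (m + 1) E ⊆ (Zee' : Set Y) := by
    rintro _ ⟨x, hx, rfl⟩
    have hx' := sphere_subset_closedBall hx
    rw [mem_sphere_zero_iff_norm, norm_eq_max] at hx
    rw [hZee']
    rcases max_choice ‖horiz x‖ |x (Fin.last m)| with h | h
    · exact Or.inl (Or.inl (hside x hx' (h ▸ hx)).1)
    · rcases eq_or_eq_neg_of_abs_eq (h ▸ hx) with h1 | h1
      · rw [htop x hx' h1]
        exact Or.inl (hclosed_e (mem_image_of_mem _ (hhoriz x hx')))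
      · rw [hbot x hx' h1]
        rcases hclosed_e' (mem_image_of_mem (RelCWComplex.map m e') (hhoriz x hx')) with h2 | h2
        · exact Or.inl (Or.inl h2)
        · exact Or.inr h2
  let Z' := insertCell Zee' (m + 1) E hE
  have hZ' : (Z' : Set Y) = (Ze : Set Y) ∪ RelCWComplex.openCell m e' ∪
      RelCWComplex.openCell (m + 1) E := rfl
  have hZ'' : (Z' : Set Y) = (Ze' : Set Y) ∪ RelCWComplex.openCell m (ι.cellMap m e) ∪
      RelCWComplex.openCell (m + 1) E := by
    rw [hZ', hZe, hZe', union_right_comm (ι.image Z : Set Y)]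
  let M' := insertCell (ι.image M) m e' hfr'
  have hM' : (M' : Set Y) = (ι.image M : Set Y) ∪ RelCWComplex.openCell m e' := rfl
  have hskel : ∀ (c : RelCWComplex.cell (univ : Set Y) m), ∀ y ∈ closedBall (0 : Fin m → ℝ) 1,
      RelCWComplex.map m c y ∈ CWComplex.skeleton (univ : Set Y) m := fun c y hy =>
    CWComplex.closedCell_subset_skeleton m c (mem_image_of_mem _ hy)
  have hfree : ∀ y ∈ closedBall (0 : Fin m → ℝ) 1, freeFace m y (Fin.last m) = 1 ∧
      horiz (freeFace m y) = y := fun y _ => ⟨Fin.snoc_last _ _, horiz_snoc _ _⟩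
  have hrefl : ∀ x ∈ closedBall (0 : Fin (m + 1) → ℝ) 1,
      reflect x ∈ closedBall (0 : Fin (m + 1) → ℝ) 1 := fun x hx => by
    rwa [mem_closedBall_zero_iff, norm_reflect, ← mem_closedBall_zero_iff]
  -- the prism collapses from its top `e` ...
  have hpair : IsCollapsePair Ze' m (ι.cellMap m e) E (RelCWComplex.map (m + 1) E) := by
    refine ⟨fun h => ?_, fun h => ?_, isCharMap_map _ _, ?_, ?_⟩
    · obtain ⟨x, hx⟩ := RelCWComplex.openCell_nonempty m (ι.cellMap m e)
      rcases openCell_subset_iff.2 h hx with h | h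
      · exact hdeZ.notMem_of_mem_left hx h
      · exact hdee'.notMem_of_mem_left hx h
    · obtain ⟨x, hx⟩ := RelCWComplex.openCell_nonempty (m + 1) E
      rcases openCell_subset_iff.2 h hx with h | h
      · exact hdEZ.notMem_of_mem_left h hx
      · exact disjoint_openCell_succ.notMem_of_mem_left h hx
    · refine (isCharMap_map m (ι.cellMap m e)).congr fun y hy => ?_
      rw [htop _ (freeFace_mem_closedBall hy) (hfree y hy).1, (hfree y hy).2]
    · intro x hx
      obtain ⟨hx, h | h⟩ := mem_baseFace_iff.1 hx
      · rw [hbot x hx h]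
        exact ⟨hclosed_e' (mem_image_of_mem _ (hhoriz x hx)), hskel _ _ (hhoriz x hx)⟩
      · exact ⟨Or.inl (hside x hx h).1, (hside x hx h).2⟩
  -- ... and, turned upside down, from its bottom `e'`
  have hpair' : IsCollapsePair Ze m e' E (RelCWComplex.map (m + 1) E ∘ reflect) := by
    refine ⟨fun h => ?_, fun h => ?_, (isCharMap_map _ _).comp_reflect, ?_, ?_⟩
    · obtain ⟨x, hx⟩ := RelCWComplex.openCell_nonempty m e'
      rcases openCell_subset_iff.2 h hx with h | h
      · exact hde'Z.notMem_of_mem_left h hx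
      · exact hdee'.notMem_of_mem_left h hx
    · obtain ⟨x, hx⟩ := RelCWComplex.openCell_nonempty (m + 1) E
      rcases openCell_subset_iff.2 h hx with h | h
      · exact hdEZ.notMem_of_mem_left h hx
      · exact disjoint_openCell_succ.notMem_of_mem_left h hx
    · refine (isCharMap_map m e').congr fun y hy => ?_
      rw [Function.comp_apply, hbot _ (hrefl _ (freeFace_mem_closedBall hy))
        (by rw [reflect_last, (hfree y hy).1]),
        horiz_reflect, (hfree y hy).2]
    · intro x hx
      obtain ⟨hx, h | h⟩ := mem_baseFace_iff.1 hx
      · rw [Function.comp_apply, htop _ (hrefl x hx) (by rw [reflect_last, h, neg_neg]),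
          horiz_reflect]
        exact ⟨hclosed_e (mem_image_of_mem _ (hhoriz x hx)), hskel _ _ (hhoriz x hx)⟩
      · have := hside _ (hrefl x hx) (by rwa [horiz_reflect])
        exact ⟨Or.inl this.1, this.2⟩
  obtain ⟨r₁, hr₁⟩ := hpair.exists_elementaryCollapsesVia hZ''
  obtain ⟨r₂, hr₂⟩ := hpair'.exists_elementaryCollapsesVia hZ'
  have hpush : ∀ {N : CWComplex.Subcomplex (univ : Set Y)} {N₀ : CWComplex.Subcomplex (univ : Set X)}
      {s : X → X}, CollapsesVia Z N₀ s → (ι.image Z : Set Y) ∩ N ⊆ ι.image N₀ →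
      ∃ s', CollapsesVia (subcomplexUnion (ι.image Z) N) (subcomplexUnion (ι.image N₀) N) s' := by
    intro N N₀ s hs hN
    refine ⟨_, (ι.collapsesVia hs).union N hN
      (r' := (ι.image Z : Set Y).piecewise (ι.pushMap s) id) (piecewise_eqOn _ _ _) fun x hx => ?_⟩
    by_cases hxZ : x ∈ (ι.image Z : Set Y)
    · rw [piecewise_eq_of_mem _ _ _ hxZ, (ι.collapsesVia hs).eqOn (hN ⟨hxZ, hx⟩)]
    · rw [piecewise_eq_of_notMem _ _ _ hxZ]
  obtain ⟨s₁, hs₁⟩ := hpush (N := M') hZM (by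
    rintro x ⟨hxZ, hx | hx⟩
    · exact hx
    · exact (hde'Z.notMem_of_mem_left hxZ hx).elim)
  obtain ⟨s₂, hs₂⟩ := hpush (N := ι.image B) hrA (by
    rw [ι.coe_image B, hAB.2, image_union, ← ι.openCell_cellMap]
    rintro x ⟨hxZ, hx | hx⟩
    · exact hx
    · exact (hdeZ.notMem_of_mem_left hx hxZ).elim)
  have hU₁ : subcomplexUnion (ι.image Z) M' = Ze' := SetLike.coe_injective <| by
    rw [coe_subcomplexUnion, hM', hZe', ← union_assoc, union_eq_self_of_subset_right hZM']
  have hU₁' : subcomplexUnion (ι.image M) M' = M' := SetLike.coe_injective <|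
    union_eq_self_of_subset_left (hM' ▸ subset_union_left)
  have hB : (ι.image B : Set Y) =
      (ι.image A : Set Y) ∪ RelCWComplex.openCell m (ι.cellMap m e) := by
    rw [ι.coe_image B, hAB.2, image_union, ι.openCell_cellMap, ι.coe_image]
  have hU₂ : subcomplexUnion (ι.image Z) (ι.image B) = Ze := SetLike.coe_injective <| by
    rw [coe_subcomplexUnion, hB, hZe, ← union_assoc,
      union_eq_self_of_subset_right (ι.image_mono hrA.subset : (ι.image A : Set Y) ⊆ ι.image Z)]
  have hU₂' : subcomplexUnion (ι.image A) (ι.image B) = ι.image B := SetLike.coe_injective <|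
    union_eq_self_of_subset_left (hB ▸ subset_union_left)
  rw [hU₁, hU₁'] at hs₁
  rw [hU₂, hU₂'] at hs₂
  refine ⟨Y, _, ‹_›, _, ‹_›, ι, Z', M', e', s₁ ∘ r₁, ?_, ?_, ?_, ⟨s₂ ∘ r₂, ?_⟩, ?_, ⟨?_, hM'⟩, he'⟩
  · exact fun x hx => Or.inl (Or.inl (Or.inl hx))
  · exact fun n hZ hm =>
      (((ι.dimLE_image hZ).insertCell (by omega)).insertCell (by omega)).insertCell hm
  · rintro x (((hx | hx) | hx) | hx)
    · exact Or.inl ((ι.injective.mem_set_image).1 hx)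
    · rw [ι.openCell_cellMap, ι.injective.mem_set_image] at hx
      exact Or.inr (hAB.2 ▸ Or.inr hx : x ∈ (B : Set X))
    · exact (hde'.notMem_of_mem_left (mem_range_self x) hx).elim
    · exact (hdE.notMem_of_mem_left (mem_range_self x) hx).elim
  · exact .step _ _ _ _ _ _ hr₂ hs₂ fun _ _ => rfl
  · exact .step _ _ _ _ _ _ hr₁ hs₁ fun _ _ => rfl
  · intro h
    obtain ⟨x, hx⟩ := RelCWComplex.openCell_nonempty m e'
    exact hde'Z.notMem_of_mem_left (hZM' (openCell_subset_iff.2 h hx)) hx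

/-! ### The successive attachment of cells -/

lemma monotone_of_isCellAttachment {X : Type u} [TopologicalSpace X] {C : Set X} [CWComplex C]
    {d : ℕ} {A : Fin (d + 1) → CWComplex.Subcomplex C} {m : Fin d → ℕ}
    {e : (j : Fin d) → RelCWComplex.cell C (m j)}
    (hA : ∀ j : Fin d, IsCellAttachment (A j.castSucc) (A j.succ) (m j) (e j)) : Monotone A :=
  Fin.monotone_iff_le_succ.2 fun j x hx => by
    have : x ∈ (A j.succ : Set X) := (hA j).2 ▸ Or.inl hx
    exact this

/-- The construction for a sequence of cells, starting from a complex `Z₀` that collapses to both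
`A 0` and `M₀`. This generality allows an induction in which the first cell is treated and `Z₀`,
`M₀` are replaced by the complexes that result from it. -/
theorem exists_expansion_and_collapse (n d : ℕ) :
    ∀ {X : Type u} [TopologicalSpace X] [T2Space X] [CWComplex (univ : Set X)]
    [CWComplex.Finite (univ : Set X)] (Z₀ M₀ : CWComplex.Subcomplex (univ : Set X))
    (A : Fin (d + 1) → CWComplex.Subcomplex (univ : Set X)) (m : Fin d → ℕ)
    (e : (j : Fin d) → RelCWComplex.cell (univ : Set X) (m j)) (r₀ : X → X),
    (∀ j : Fin d, IsCellAttachment (A j.castSucc) (A j.succ) (m j) (e j)) →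
    (∀ j, e j ∉ Z₀.I (m j)) → (∀ j, m j ≤ n) → (∀ _ : Fin d, DimLE Z₀ (n + 1)) →
    Collapses Z₀ (A 0) → CollapsesVia Z₀ M₀ r₀ →
    ∃ (Y : Type u) (_ : TopologicalSpace Y) (_ : T2Space Y) (_ : CWComplex (univ : Set Y))
      (_ : CWComplex.Finite (univ : Set Y))
      (ι : CellularInclusion X Y)
      (Z M : Fin (d + 1) → CWComplex.Subcomplex (univ : Set Y))
      (e' : (j : Fin d) → RelCWComplex.cell (univ : Set Y) (m j))
      (r : Fin (d + 1) → Y → Y),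
      Z 0 = ι.image Z₀ ∧ M 0 = ι.image M₀ ∧ (∀ x, r 0 (ι.toFun x) = ι.toFun (r₀ x)) ∧
      Monotone Z ∧
      (∀ j : Fin d, DimLE (Z j.succ) (n + 1)) ∧
      (∀ j : Fin d, Collapses (Z j.succ) (ι.image (A j.succ))) ∧
      (∀ j : Fin (d + 1), CollapsesVia (Z j) (M j) (r j)) ∧
      (∀ j : Fin d, IsCellAttachment (M j.castSucc) (M j.succ) (m j) (e' j)) ∧
      (∀ j : Fin d, ∀ x ∈ sphere (0 : Fin (m j) → ℝ) 1,
        RelCWComplex.map (m j) (e' j) x =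
          r j.castSucc (ι.toFun (RelCWComplex.map (m j) (e j) x))) := by
  induction d with
  | zero =>
    intro X _ _ _ _ Z₀ M₀ A m e r₀ hA he hn hdim hZA hZM
    refine ⟨X, _, ‹_›, _, ‹_›, CellularInclusion.id X, fun _ => Z₀, fun _ => M₀, fun j => j.elim0,
      fun _ => r₀, ?_, ?_, fun _ => rfl, monotone_const, fun j => j.elim0, fun j => j.elim0,
      fun _ => hZM, fun j => j.elim0, fun j => j.elim0⟩
    · rw [CellularInclusion.id_image]
    · rw [CellularInclusion.id_image]
  | succ d ih =>
    intro X _ _ _ _ Z₀ M₀ A m e r₀ hA he hn hdim hZA hZM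
    obtain ⟨X₁, _, _, _, _, ι₁, Z₁, M₁, e₁, r₁, hZ₁, hdim₁, hpre, hZA₁, hZM₁, hM₁, he₁⟩ :=
      exists_collapses_of_isCellAttachment (hA 0) (he 0) hZA hZM
    have hmono := monotone_of_isCellAttachment hA
    -- the remaining cells are not in `Z₁`, which meets `X` in `Z₀ ∪ A 1`
    have hnot : ∀ j : Fin d, ι₁.cellMap _ (e j.succ) ∉ Z₁.I (m j.succ) := by
      intro j h
      obtain ⟨x, hx⟩ := RelCWComplex.openCell_nonempty _ (e j.succ)
      have hxZ : ι₁.toFun x ∈ (Z₁ : Set X₁) :=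
        openCell_subset_iff.2 h (ι₁.openCell_cellMap _ _ ▸ mem_image_of_mem _ hx)
      rcases hpre hxZ with hx' | hx'
      · exact he j.succ (mem_I_of_mem_openCell hx hx')
      · refine (hA j.succ).1 (mem_I_of_mem_openCell hx (hmono ?_ hx'))
        rw [Fin.le_iff_val_le_val]
        simp
    obtain ⟨Y, _, _, _, _, ι₂, Z, M, e', r, hZ0, hM0, hr0, hZmono, hZdim, hZA', hZM', hM', he'⟩ :=
      ih Z₁ M₁ (fun j => ι₁.image (A j.succ)) (fun j => m j.succ)
        (fun j => ι₁.cellMap _ (e j.succ)) r₁ (fun j => ι₁.isCellAttachment (hA j.succ)) hnot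
        (fun j => hn j.succ) (fun _ => hdim₁ _ (hdim 0) (by have := hn 0; omega)) hZA₁ hZM₁
    have hd₁ : DimLE Z₁ (n + 1) := hdim₁ _ (hdim 0) (by have := hn 0; omega)
    refine ⟨Y, _, ‹_›, _, ‹_›, ι₂.comp ι₁,
      Fin.cons (α := fun _ => CWComplex.Subcomplex (univ : Set Y)) ((ι₂.comp ι₁).image Z₀) Z,
      Fin.cons (α := fun _ => CWComplex.Subcomplex (univ : Set Y)) ((ι₂.comp ι₁).image M₀) M,
      Fin.cons (α := fun j => RelCWComplex.cell (univ : Set Y) (m j)) (ι₂.cellMap _ e₁) e',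
      Fin.cons (α := fun _ => Y → Y) ((ι₂.comp ι₁).pushMap r₀) r,
      rfl, rfl, fun x => (ι₂.comp ι₁).pushMap_apply r₀ x, ?_, ?_, ?_, ?_, ?_, ?_⟩
    · refine Fin.monotone_iff_le_succ.2 fun j => ?_
      refine Fin.cases ?_ (fun j => ?_) j
      · change (ι₂.comp ι₁).image Z₀ ≤ Z 0
        rw [hZ0, CellularInclusion.comp_image]
        exact ι₂.image_mono hZ₁
      · exact hZmono (Fin.castSucc_le_succ j)
    · refine fun j => Fin.cases ?_ (fun j => hZdim j) j
      change DimLE (Z 0) _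
      exact hZ0 ▸ ι₂.dimLE_image hd₁
    · refine fun j => Fin.cases ?_ (fun j => ?_) j
      · change Collapses (Z 0) _
        obtain ⟨s, hs⟩ := hZA₁
        rw [hZ0, CellularInclusion.comp_image]
        exact ⟨_, ι₂.collapsesVia hs⟩
      · have := hZA' j
        rw [← CellularInclusion.comp_image] at this
        exact this
    · exact fun j => Fin.cases ((ι₂.comp ι₁).collapsesVia hZM) (fun j => hZM' j) j
    · refine fun j => Fin.cases ?_ (fun j => hM' j) j
      change IsCellAttachment ((ι₂.comp ι₁).image M₀) (M 0) _ _
      rw [hM0, CellularInclusion.comp_image]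
      exact ι₂.isCellAttachment hM₁
    · refine fun j => Fin.cases ?_ (fun j => ?_) j
      · intro x hx
        change RelCWComplex.map (m 0) (ι₂.cellMap _ e₁) x =
          (ι₂.comp ι₁).pushMap r₀ ((ι₂.comp ι₁).toFun _)
        rw [CellularInclusion.pushMap_apply, ← ι₂.map_eq _ _ _ (sphere_subset_closedBall hx),
          he₁ x hx]
        rfl
      · intro x hx
        have := he' j x hx
        rw [← ι₁.map_eq _ _ _ (sphere_subset_closedBall hx)] at this
        exact this

end InternalCollapse

end

theorem mainTheorem6 {X : Type u} [TopologicalSpace X] [T2Space X] [CWComplex (univ : Set X)]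
    [CWComplex.Finite (univ : Set X)] (n d : ℕ)
    -- the subcomplexes `A j = K ∪ e₁ ∪ … ∪ e_j` of `X = K ∪ e₁ ∪ … ∪ e_d`
    (K L : CWComplex.Subcomplex (univ : Set X))
    (A : Fin (d + 1) → CWComplex.Subcomplex (univ : Set X))
    (m : Fin d → ℕ) (e : (j : Fin d) → RelCWComplex.cell (univ : Set X) (m j))
    (hA_zero : A 0 = K) (hA_last : (A (Fin.last d) : Set X) = univ)
    (hA : ∀ j : Fin d, InternalCollapse.IsCellAttachment (A j.castSucc) (A j.succ) (m j) (e j))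
    -- `dim K ≤ dim e_j ≤ dim e_{j+1} ≤ n`
    (hK : ∀ j, InternalCollapse.DimLE K (m j)) (hm : Monotone m) (hn : ∀ j, m j ≤ n)
    -- `K` collapses to `L`, with canonical strong deformation retraction `r₀`
    (r₀ : X → X) (hr₀ : InternalCollapse.CollapsesVia K L r₀) :
    ∃ (Y : Type u) (_ : TopologicalSpace Y) (_ : T2Space Y) (_ : CWComplex (univ : Set Y))
      (_ : CWComplex.Finite (univ : Set Y))
      (ι : InternalCollapse.CellularInclusion X Y)
      -- `Z j` for `j ≥ 1`, with `Z 0 = K`, and `M j = L ∪ ẽ₁ ∪ … ∪ ẽ_j`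
      (Z M : Fin (d + 1) → CWComplex.Subcomplex (univ : Set Y))
      (e' : (j : Fin d) → RelCWComplex.cell (univ : Set Y) (m j))
      (r : Fin (d + 1) → Y → Y),
      Z 0 = ι.image K ∧ M 0 = ι.image L ∧ (∀ x ∈ K, r 0 (ι.toFun x) = ι.toFun (r₀ x)) ∧
      Monotone Z ∧
      (∀ j : Fin d, InternalCollapse.DimLE (Z j.succ) (n + 1)) ∧
      (∀ j : Fin d, InternalCollapse.Collapses (Z j.succ) (ι.image (A j.succ))) ∧
      (∀ j : Fin d, InternalCollapse.CollapsesVia (Z j.succ) (M j.succ) (r j.succ)) ∧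
      (∀ j : Fin (d + 1),
        InternalCollapse.IsStrongDeformationRetraction (Z j : Set Y) (M j : Set Y) (r j)) ∧
      (∀ j : Fin d,
        InternalCollapse.IsCellAttachment (M j.castSucc) (M j.succ) (m j) (e' j)) ∧
      -- the attaching map of the `(j+1)`-st new cell is `r j ∘ ι ∘ φ_{j+1}`
      (∀ j : Fin d, ∀ x ∈ sphere (0 : Fin (m j) → ℝ) 1,
        RelCWComplex.map (m j) (e' j) x = r j.castSucc (ι.toFun (RelCWComplex.map (m j) (e j) x))) := by
  have hmono := InternalCollapse.monotone_of_isCellAttachment hA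
  have he : ∀ j, e j ∉ K.I (m j) := by
    intro j h
    obtain ⟨x, hx⟩ := RelCWComplex.openCell_nonempty _ (e j)
    have hxK : x ∈ A 0 := hA_zero ▸ InternalCollapse.openCell_subset_iff.2 h hx
    exact (hA j).1 (InternalCollapse.mem_I_of_mem_openCell hx (hmono (Fin.zero_le _) hxK))
  obtain ⟨Y, _, _, _, _, ι, Z, M, e', r, hZ0, hM0, hr0, hZmono, hZdim, hZA, hZM, hM, he'⟩ :=
    InternalCollapse.exists_expansion_and_collapse n d K L A m e r₀ hA he hn
      (fun j k hk => hK j k (by have := hn j; omega))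
      ⟨id, hA_zero ▸ .refl _ _ fun _ _ => rfl⟩ hr₀
  refine ⟨Y, _, ‹_›, _, ‹_›, ι, Z, M, e', r, hZ0, hM0, fun x _ => hr0 x, hZmono, hZdim, hZA,
    fun j => hZM j.succ, fun j => ?_, hM, he'⟩
  obtain ⟨H, hH⟩ := (hZM j).exists_isCellularDeformation
  exact hH.isStrongDeformationRetraction
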